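/- Consider the word RAM with $w$-bit words: a fixed finite program, which does not depend on $w$ or on the input, performs in one step an arithmetic operation on words, a comparison of two registers, or a read or write of a memory cell whose address consists of a constant number of words. An instance of the transitive $d$-simultaneous conjugacy problem ($d$-SCP) in the symmetric group $S_n$ ($n, d \ge 1$) consists of two ordered $d$-tuples $a = (a_1,\dots,a_d)$ and $b = (b_1,\dots,b_d)$ of permutations in $S_n$, given as tables of values, such that each tuple generates a transitive subgroup of $S_n$; the question is whether there is a $\tau \in S_n$ with $b_j = \tau^{-1} a_j \tau$ for all $j = 1,\dots,d$. Let $\lambda$ be the minimum over $j$ of the number of cycles (fixed points included) in the cycle decomposition of $a_j$. There is a program that halts on every instance of the transitive $d$-SCP in $S_n$, for all $n, d \ge 1$ and every word length $w$ with $n, d < 2^w$, with the correct answer, and that has the following property: for every constant $\Lambda$ there is a constant $C$, depending only on $\Lambda$, such that on every such instance with $n \ge 2$ and $\lambda \le \Lambda$ the program halts after at most $C\, d\, n \log n$ steps. That is, if $\lambda = O(1)$, then the transitive $d$-SCP in $S_n$ can be solved in $O(dn\log n)$ time. -/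

import Mathlib

/-! # Simultaneous conjugacy in the symmetric group, and a word RAM with a step count -/

section Conjugacy

/-- The ordered tuples `a` and `b` of permutations are simultaneously conjugate:
one permutation `τ` satisfies `b j = τ⁻¹ * a j * τ` for every index `j`. -/
def SimultaneouslyConjugate {n d : ℕ} (a b : Fin d → Equiv.Perm (Fin n)) : Prop :=
  ∃ τ : Equiv.Perm (Fin n), ∀ j, b j = τ⁻¹ * a j * τ

/-- The tuple `a` generates a transitive subgroup of the symmetric group. -/
def GeneratesTransitive {n d : ℕ} (a : Fin d → Equiv.Perm (Fin n)) : Prop :=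
  MulAction.IsPretransitive (Subgroup.closure (Set.range a)) (Fin n)

/-- The number of cycles in the cycle decomposition of `σ`, fixed points included. -/
def numCycles {n : ℕ} (σ : Equiv.Perm (Fin n)) : ℕ :=
  σ.partition.parts.card

/-- The least number of cycles of an entry of the tuple (used for nonempty tuples only). -/
noncomputable def minCycles {n d : ℕ} (a : Fin d → Equiv.Perm (Fin n)) : ℕ :=
  ⨅ j, numCycles (a j)

end Conjugacy

namespace WordRAM

/-- Binary operations on words. The result of each is reduced modulo `2 ^ w` when it is written
to a register of a machine with `w`-bit words. -/
inductive Op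
  | add
  | sub
  | mul
  | div
  | mod

/-- Subtraction is cut off at `0`; `x / 0 = 0` and `x % 0 = x`. -/
def Op.eval : Op → ℕ → ℕ → ℕ
  | .add, x, y => x + y
  | .sub, x, y => x - y
  | .mul, x, y => x * y
  | .div, x, y => x / y
  | .mod, x, y => x % y

/-- The configuration of the machine: registers, and a random-access memory whose cells are
addressed by a segment number and two words. In a program the numbers of registers and
segments are literal constants, so it uses only finitely many of either. -/
structure State where
  reg : ℕ → ℕ
  mem : ℕ → ℕ → ℕ → ℕ

/-- Write the value `v`, truncated to a `w`-bit word, to register `x`. -/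
def State.setReg (w : ℕ) (s : State) (x v : ℕ) : State :=
  { s with reg := Function.update s.reg x (v % 2 ^ w) }

/-- Write the word `v` to the cell `(i, j)` of segment `k`. -/
def State.setMem (s : State) (k i j v : ℕ) : State :=
  { s with
    mem := Function.update s.mem k
      (Function.update (s.mem k) i (Function.update (s.mem k i) j v)) }

/-- Comparisons of two registers. -/
inductive Test
  | eq (x y : ℕ)
  | lt (x y : ℕ)

def Test.Holds : Test → State → Prop
  | .eq x y, s => s.reg x = s.reg y
  | .lt x y, s => s.reg x < s.reg y

/-- RAM programs. A program is a finite text that does not depend on the word length. -/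
inductive Prog
  /-- do nothing -/
  | skip
  /-- `reg x := c` -/
  | const (x c : ℕ)
  /-- `reg x := reg y` -/
  | copy (x y : ℕ)
  /-- `reg x := o (reg y) (reg z)` -/
  | op (o : Op) (x y z : ℕ)
  /-- `reg x := mem k (reg y) (reg z)` -/
  | load (x k y z : ℕ)
  /-- `mem k (reg y) (reg z) := reg x` -/
  | store (k y z x : ℕ)
  /-- one program after the other -/
  | seq (p q : Prog)
  /-- conditional branching -/
  | ite (c : Test) (p q : Prog)
  /-- repeat `p` as long as the test holds -/
  | loop (c : Test) (p : Prog)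

/-- `Run w p s t s'`: on the machine with `w`-bit words, the program `p` started in state `s`
halts in state `s'` after exactly `t` steps. Every elementary instruction and every evaluation
of a test is one step. -/
inductive Run (w : ℕ) : Prog → State → ℕ → State → Prop
  | skip (s : State) : Run w .skip s 1 s
  | const (x c : ℕ) (s : State) : Run w (.const x c) s 1 (s.setReg w x c)
  | copy (x y : ℕ) (s : State) : Run w (.copy x y) s 1 (s.setReg w x (s.reg y))
  | op (o : Op) (x y z : ℕ) (s : State) :
      Run w (.op o x y z) s 1 (s.setReg w x (o.eval (s.reg y) (s.reg z)))
  | load (x k y z : ℕ) (s : State) :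
      Run w (.load x k y z) s 1 (s.setReg w x (s.mem k (s.reg y) (s.reg z)))
  | store (k y z x : ℕ) (s : State) :
      Run w (.store k y z x) s 1 (s.setMem k (s.reg y) (s.reg z) (s.reg x))
  | seq {p q : Prog} {s s₁ s₂ : State} {t₁ t₂ : ℕ} (hp : Run w p s t₁ s₁)
      (hq : Run w q s₁ t₂ s₂) : Run w (.seq p q) s (t₁ + t₂) s₂
  | ite_true {c : Test} {p q : Prog} {s s₁ : State} {t : ℕ} (hc : c.Holds s)
      (hp : Run w p s t s₁) : Run w (.ite c p q) s (t + 1) s₁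
  | ite_false {c : Test} {p q : Prog} {s s₁ : State} {t : ℕ} (hc : ¬ c.Holds s)
      (hq : Run w q s t s₁) : Run w (.ite c p q) s (t + 1) s₁
  | loop_true {c : Test} {p : Prog} {s s₁ s₂ : State} {t₁ t₂ : ℕ} (hc : c.Holds s)
      (hp : Run w p s t₁ s₁) (hl : Run w (.loop c p) s₁ t₂ s₂) :
      Run w (.loop c p) s (t₁ + t₂ + 1) s₂
  | loop_false {c : Test} {p : Prog} {s : State} (hc : ¬ c.Holds s) :
      Run w (.loop c p) s 1 s

/-- The table of a tuple of permutations of `{0, …, n - 1}`: entry `(j, i)` is the image of `i`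
under the `j`-th permutation; outside of the index range the table is `0`. -/
def table {n d : ℕ} (a : Fin d → Equiv.Perm (Fin n)) (j i : ℕ) : ℕ :=
  if h : j < d ∧ i < n then (a ⟨j, h.1⟩ ⟨i, h.2⟩ : ℕ) else 0

/-- The initial state for the input `(a, b)`: registers `0` and `1` hold `n` and `d`, segments `0`
and `1` hold the tables of `a` and `b`, and everything else is `0`. -/
def input {n d : ℕ} (a b : Fin d → Equiv.Perm (Fin n)) : State where
  reg x := if x = 0 then n else if x = 1 then d else 0
  mem k := if k = 0 then table a else if k = 1 then table b else fun _ _ => 0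

/-- A halting state answers `yes` if register `0` is nonzero, and `no` otherwise. -/
def State.Accepts (s : State) : Prop := s.reg 0 ≠ 0

end WordRAM

/-! A cyclic order of all points that is built canonically from the tuple reduces conjugacy to
equality of words up to rotation. Take a longest cycle among all `a j`, of length `L`, say of `a
j₀`, and grow it by breadth-first search: whenever the image of a frontier point `r` under some `a
j` is new, it is inserted directly behind `r`. By transitivity every point gets inserted. The result
does not depend on the labels of the points, so a conjugating `τ` carries the order grown from a
cycle of `b j₀` to the order grown from its image (`CycConfig.Conj.start`,
`CycConfig.Conj.bfs_of_empty`).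

Relative to a cyclic order, a permutation is the list of its displacements: how many steps lead from
`x` to its image. The tuple thus becomes a cyclic word of length `n` whose letters are `d`-tuples of
numbers below `n`. Equal words up to rotation yield a conjugating permutation
(`Displacement.exists_isIso`), and a conjugating permutation compatible with the orders yields equal
words (`Displacement.dispWord_eq_of_isIso`).

Rotations are compared in `O(dn)` steps by discarding starting positions: a mismatch after `k` equal
letters shows that `k + 1` consecutive rotations of the larger word are not minimal among the
rotations of both words, and two equivalent words share their minimal rotation (`ShiftsBeaten.add`,
`ShiftsBeaten.lt_of_shift_eq`, `wp_compare`).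

A conjugating `τ` sends some cycle of `b j₀` of length `L` to the chosen cycle, so it is enough to
try each of these. An entry with `λ` cycles has a cycle of length at least `n / λ`
(`le_numCycles_mul`), so `n ≤ λ * L` and there are at most `n / L ≤ λ` trials of cost `O(dn)`
(`wp_matchCycles`). The program never uses `λ`, which enters only the count of steps. The total is
`O(λ d n)`; the logarithm is needed only to match the stated form of the bound. -/

namespace WordRAM

/-! ## Weakest preconditions with a step count -/

/-- `p` halts when started in `s`, after `t` steps in a state `s'` with `Q t s'`. -/
def WP (w : ℕ) (p : Prog) (Q : ℕ → State → Prop) (s : State) : Prop :=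
  ∃ t s', Run w p s t s' ∧ Q t s'

/-- The registers that `p` may write. -/
def Prog.regs : Prog → List ℕ
  | .skip => []
  | .const x _ => [x]
  | .copy x _ => [x]
  | .op _ x _ _ => [x]
  | .load x _ _ _ => [x]
  | .store _ _ _ _ => []
  | .seq p q => p.regs ++ q.regs
  | .ite _ p q => p.regs ++ q.regs
  | .loop _ p => p.regs

/-- The memory segments that `p` may write. -/
def Prog.segs : Prog → List ℕ
  | .skip => []
  | .const _ _ => []
  | .copy _ _ => []
  | .op _ _ _ _ => []
  | .load _ _ _ _ => []
  | .store k _ _ _ => [k]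
  | .seq p q => p.segs ++ q.segs
  | .ite _ p q => p.segs ++ q.segs
  | .loop _ p => p.segs

/-- The states `s` and `s'` agree wherever `p` does not write. -/
structure Frame (p : Prog) (s s' : State) : Prop where
  reg : ∀ x, x ∉ p.regs → s'.reg x = s.reg x
  mem : ∀ k, k ∉ p.segs → s'.mem k = s.mem k

theorem Frame.refl (p : Prog) (s : State) : Frame p s s := ⟨fun _ _ => rfl, fun _ _ => rfl⟩

theorem Frame.trans {p : Prog} {s s' s'' : State} (h : Frame p s s') (h' : Frame p s' s'') :
    Frame p s s'' :=
  ⟨fun x hx => (h'.reg x hx).trans (h.reg x hx), fun k hk => (h'.mem k hk).trans (h.mem k hk)⟩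

section simps
variable {w : ℕ} (s : State) (x y v k i j k' i' j' : ℕ)

@[simp] theorem setReg_reg :
    (s.setReg w x v).reg y = if y = x then v % 2 ^ w else s.reg y := by
  simp [State.setReg, Function.update_apply]

@[simp] theorem setReg_mem : (s.setReg w x v).mem = s.mem := rfl

@[simp] theorem setMem_reg : (s.setMem k i j v).reg = s.reg := rfl

@[simp] theorem setMem_mem :
    (s.setMem k i j v).mem k' i' j' = if k' = k ∧ i' = i ∧ j' = j then v else s.mem k' i' j' := by
  by_cases hk : k' = k
  · subst hk
    by_cases hi : i' = i
    · subst hi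
      simp [State.setMem, Function.update_apply]
    · simp [State.setMem, hi]
  · simp [State.setMem, hk]

theorem setMem_mem_of_ne (h : k' ≠ k) : (s.setMem k i j v).mem k' = s.mem k' := by
  simp [State.setMem, h]

end simps

/-- Induction on the run. It makes every correctness statement local: registers and segments that a
program does not write are handled by membership in two finite lists. -/
theorem Run.frame {w : ℕ} {p : Prog} {s s' : State} {t : ℕ} (h : Run w p s t s') :
    Frame p s s' := by
  induction h with
  | skip s => exact Frame.refl _ _
  | const | copy | op | load =>
    refine ⟨fun x hx => ?_, fun _ _ => rfl⟩
    simp only [Prog.regs, List.mem_singleton] at hx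
    simp [hx]
  | store =>
    refine ⟨fun x hx => rfl, fun k hk => ?_⟩
    simp only [Prog.segs, List.mem_singleton] at hk
    exact setMem_mem_of_ne _ _ _ _ _ _ hk
  | seq _ _ h₁ h₂ =>
    refine ⟨fun x hx => ?_, fun k hk => ?_⟩
    · simp only [Prog.regs, List.mem_append, not_or] at hx
      rw [h₂.reg x hx.2, h₁.reg x hx.1]
    · simp only [Prog.segs, List.mem_append, not_or] at hk
      rw [h₂.mem k hk.2, h₁.mem k hk.1]
  | ite_true _ _ h | ite_false _ _ h =>
    refine ⟨fun x hx => ?_, fun k hk => ?_⟩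
    · simp only [Prog.regs, List.mem_append, not_or] at hx
      simp only [h.reg x, hx, not_false_eq_true]
    · simp only [Prog.segs, List.mem_append, not_or] at hk
      simp only [h.mem k, hk, not_false_eq_true]
  | loop_true _ _ _ h₁ h₂ => exact Frame.trans (p := .loop _ _) ⟨h₁.reg, h₁.mem⟩ h₂
  | loop_false => exact Frame.refl _ _

section rules
variable {w : ℕ} {p q : Prog} {Q Q' : ℕ → State → Prop} {s : State} {c : Test}

/-- The frame comes for free, so postconditions never have to mention unchanged parts of the state.
-/
theorem WP.mono (h : WP w p Q s) (hQ : ∀ t s', Q t s' → Frame p s s' → Q' t s') :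
    WP w p Q' s := by
  obtain ⟨t, s', hr, hq⟩ := h
  exact ⟨t, s', hr, hQ t s' hq hr.frame⟩

@[simp] theorem wp_skip : WP w .skip Q s ↔ Q 1 s :=
  ⟨by rintro ⟨t, s', ⟨⟩, h⟩; exact h, fun h => ⟨_, _, .skip _, h⟩⟩

@[simp] theorem wp_const {x v : ℕ} : WP w (.const x v) Q s ↔ Q 1 (s.setReg w x v) :=
  ⟨by rintro ⟨t, s', ⟨⟩, h⟩; exact h, fun h => ⟨_, _, .const _ _ _, h⟩⟩

@[simp] theorem wp_copy {x y : ℕ} : WP w (.copy x y) Q s ↔ Q 1 (s.setReg w x (s.reg y)) :=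
  ⟨by rintro ⟨t, s', ⟨⟩, h⟩; exact h, fun h => ⟨_, _, .copy _ _ _, h⟩⟩

@[simp] theorem wp_op {o : Op} {x y z : ℕ} :
    WP w (.op o x y z) Q s ↔ Q 1 (s.setReg w x (o.eval (s.reg y) (s.reg z))) :=
  ⟨by rintro ⟨t, s', ⟨⟩, h⟩; exact h, fun h => ⟨_, _, .op _ _ _ _ _, h⟩⟩

@[simp] theorem wp_load {x k y z : ℕ} :
    WP w (.load x k y z) Q s ↔ Q 1 (s.setReg w x (s.mem k (s.reg y) (s.reg z))) :=
  ⟨by rintro ⟨t, s', ⟨⟩, h⟩; exact h, fun h => ⟨_, _, .load _ _ _ _ _, h⟩⟩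

@[simp] theorem wp_store {k y z x : ℕ} :
    WP w (.store k y z x) Q s ↔ Q 1 (s.setMem k (s.reg y) (s.reg z) (s.reg x)) :=
  ⟨by rintro ⟨t, s', ⟨⟩, h⟩; exact h, fun h => ⟨_, _, .store _ _ _ _ _, h⟩⟩

@[simp] theorem wp_seq :
    WP w (.seq p q) Q s ↔ WP w p (fun t s' => WP w q (fun t' s'' => Q (t + t') s'') s') s := by
  constructor
  · rintro ⟨t, s', h, hq⟩
    cases h with
    | seq h₁ h₂ => exact ⟨_, _, h₁, _, _, h₂, hq⟩
  · rintro ⟨_, _, h₁, _, _, h₂, hq⟩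
    exact ⟨_, _, .seq h₁ h₂, hq⟩

theorem wp_ite : WP w (.ite c p q) Q s ↔
    (c.Holds s → WP w p (fun t s' => Q (t + 1) s') s) ∧
      (¬ c.Holds s → WP w q (fun t s' => Q (t + 1) s') s) := by
  constructor
  · rintro ⟨t, s', h, hq⟩
    cases h with
    | ite_true hc h => exact ⟨fun _ => ⟨_, _, h, hq⟩, fun hn => absurd hc hn⟩
    | ite_false hc h => exact ⟨fun hn => absurd hn hc, fun _ => ⟨_, _, h, hq⟩⟩
  · rintro ⟨h₁, h₂⟩
    by_cases hc : c.Holds s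
    · obtain ⟨_, _, h, hq⟩ := h₁ hc
      exact ⟨_, _, .ite_true hc h, hq⟩
    · obtain ⟨_, _, h, hq⟩ := h₂ hc
      exact ⟨_, _, .ite_false hc h, hq⟩

/-- The loop rule: the invariant `I φ` carries a bound `φ` for the remaining number of steps. -/
theorem wp_loop (I : ℕ → State → Prop) {φ : ℕ} (h₀ : I φ s)
    (h : ∀ φ s', I φ s' → Frame p s s' → c.Holds s' →
      WP w p (fun t s'' => ∃ φ', t + 1 + φ' ≤ φ ∧ I φ' s'') s') :
    WP w (.loop c p) (fun t s' => ¬ c.Holds s' ∧ ∃ φ', t + φ' ≤ φ + 1 ∧ I φ' s') s := by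
  suffices H : ∀ φ s', I φ s' → Frame p s s' →
      WP w (.loop c p) (fun t s'' => ¬ c.Holds s'' ∧ ∃ φ', t + φ' ≤ φ + 1 ∧ I φ' s'') s' from
    H φ s h₀ (Frame.refl _ _)
  intro φ
  -- The remaining budget is the termination measure; it drops in every round because evaluating the
  -- test costs a step.
  induction φ using Nat.strong_induction_on with
  | _ φ ih =>
    intro s' hI hf
    by_cases hc : c.Holds s'
    · obtain ⟨t, s₁, hr, φ', hle, hI'⟩ := h φ s' hI hf hc
      obtain ⟨t', s₂, hr', hn, φ'', hφ, hI''⟩ :=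
        ih φ' (by omega) s₁ hI' (hf.trans hr.frame)
      exact ⟨_, _, .loop_true hc hr hr', hn, φ'', by omega, hI''⟩
    · exact ⟨_, _, .loop_false hc, hc, φ, by omega, hI⟩

end rules

/-- Run `p` for the values `0, 1, …` of register `i` below the value of register `N`. -/
def forLoop (i N : ℕ) (p : Prog) : Prog :=
  .seq (.const i 0) (.loop (.lt i N) (.seq p (.op .add i i 2)))

/-- The rule for counting loops, with amortized cost `c` of the body. -/
theorem wp_forLoop {w : ℕ} {p : Prog} {s : State} {i N : ℕ} (I : ℕ → ℕ → State → Prop)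
    {φ c : ℕ} (hone : s.reg 2 = 1) (hN : s.reg N < 2 ^ w)
    (hp : i ∉ p.regs ∧ N ∉ p.regs ∧ 2 ∉ p.regs ∧ N ≠ i ∧ i ≠ 2)
    (h₀ : I 0 φ (s.setReg w i 0))
    (h : ∀ m φ s', m < s.reg N → s'.reg i = m → I m φ s' → Frame (forLoop i N p) s s' →
      WP w p (fun t s'' => ∃ φ', t + φ' ≤ c + φ ∧ I (m + 1) φ' (s''.setReg w i (m + 1))) s') :
    WP w (forLoop i N p)
      (fun t s' => ∃ φ', t + φ' ≤ s.reg N * (c + 2) + φ + 2 ∧ I (s.reg N) φ' s') s := by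
  obtain ⟨hi, hN', h2, hNi, hi2⟩ := hp
  rw [forLoop, wp_seq, wp_const]
  have hf₀ : Frame (forLoop i N p) s (s.setReg w i 0) := by
    refine ⟨fun x hx => ?_, fun _ _ => rfl⟩
    simp only [forLoop, Prog.regs, List.cons_append, List.mem_cons, not_or] at hx
    simp [hx.1]
  have key := wp_loop (w := w) (c := .lt i N) (p := .seq p (.op .add i i 2))
    (s := s.setReg w i 0)
    -- Each remaining round is budgeted `c + 2`: the amortized body, the increment and the test. The
    -- rest `φ'` is the potential from which expensive rounds are paid.
    (fun ψ s' => ∃ m φ', m ≤ s.reg N ∧ s'.reg i = m ∧ I m φ' s' ∧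
      ψ = (s.reg N - m) * (c + 2) + φ')
    (φ := s.reg N * (c + 2) + φ) ⟨0, φ, by omega, by simp, h₀, by simp⟩ ?_
  · refine key.mono fun t s' ⟨hn, ψ, ht, m, φ', hm, him, hI, hψ⟩ hf => ?_
    have hNs : s'.reg N = s.reg N := by
      rw [hf.reg N (by simp [Prog.regs, hN', hNi])]; simp [hNi]
    simp only [Test.Holds, him, hNs, not_lt] at hn
    obtain rfl : m = s.reg N := le_antisymm hm hn
    exact ⟨φ', by simp at hψ; omega, hI⟩
  · rintro ψ s' ⟨m, φ', hm, him, hI, hψ⟩ hf hc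
    have hf' : Frame (forLoop i N p) s s' :=
      hf₀.trans ⟨fun x hx => hf.reg x (by simp_all [forLoop, Prog.regs]),
        fun k hk => hf.mem k (by simp_all [forLoop, Prog.segs])⟩
    have hNs : s'.reg N = s.reg N := hf'.reg N (by simp [forLoop, Prog.regs, hN', hNi])
    have h2s : s'.reg 2 = 1 := by
      rw [hf'.reg 2 (by simp [forLoop, Prog.regs, h2, hi2.symm]), hone]
    simp only [Test.Holds, him, hNs] at hc
    rw [wp_seq]
    refine (h m φ' s' hc him hI hf').mono fun t s'' ⟨φ'', ht, hI'⟩ hf'' => ?_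
    rw [wp_op, Op.eval, hf''.reg i hi, hf''.reg 2 h2, h2s, him]
    refine ⟨(s.reg N - (m + 1)) * (c + 2) + φ'', ?_, m + 1, φ'', hc, ?_, hI', rfl⟩
    · obtain ⟨e, he⟩ : ∃ e, s.reg N - m = e + 1 := ⟨s.reg N - m - 1, by omega⟩
      rw [hψ, he, show s.reg N - (m + 1) = e by omega, Nat.succ_mul]
      omega
    · simp [Nat.mod_eq_of_lt (show m + 1 < 2 ^ w by omega)]

/-- The rule for counting loops whose body takes at most `c` steps. -/
theorem wp_forLoop_const {w : ℕ} {p : Prog} {s : State} {i N : ℕ} (I : ℕ → State → Prop)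
    (c : ℕ) (hone : s.reg 2 = 1) (hN : s.reg N < 2 ^ w)
    (hp : i ∉ p.regs ∧ N ∉ p.regs ∧ 2 ∉ p.regs ∧ N ≠ i ∧ i ≠ 2)
    (h₀ : I 0 (s.setReg w i 0))
    (h : ∀ m s', m < s.reg N → s'.reg i = m → I m s' → Frame (forLoop i N p) s s' →
      WP w p (fun t s'' => t ≤ c ∧ I (m + 1) (s''.setReg w i (m + 1))) s') :
    WP w (forLoop i N p) (fun t s' => t ≤ s.reg N * (c + 2) + 2 ∧ I (s.reg N) s') s := by
  refine (wp_forLoop (fun m φ s => φ = 0 ∧ I m s) (c := c) hone hN hp ⟨rfl, h₀⟩ ?_).mono ?_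
  · rintro m φ s' hm him ⟨rfl, hI⟩ hf
    exact (h m s' hm him hI hf).mono fun t s'' ⟨ht, hI⟩ _ => ⟨0, by omega, rfl, hI⟩
  · rintro t s' ⟨φ, ht, rfl, hI⟩ -
    exact ⟨by omega, hI⟩

end WordRAM

open Function

/-! ## Cyclic orders grown by breadth-first search -/

/-- `σ` permutes the finite set `R` in one cycle through `v`. -/
structure OneCycle (v : ℕ) (R : Finset ℕ) (σ : ℕ → ℕ) : Prop where
  mem : v ∈ R
  mapsTo : ∀ x ∈ R, σ x ∈ R
  reach : ∀ x ∈ R, ∃ k, σ^[k + 1] v = x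

namespace OneCycle
variable {v : ℕ} {R : Finset ℕ} {σ : ℕ → ℕ}

theorem iterate_mem (h : OneCycle v R σ) {x : ℕ} (hx : x ∈ R) (k : ℕ) : σ^[k] x ∈ R := by
  induction k with
  | zero => exact hx
  | succ k ih => rw [iterate_succ_apply']; exact h.mapsTo _ ih

theorem mem_periodicPts (h : OneCycle v R σ) : v ∈ periodicPts σ := by
  obtain ⟨k, hk⟩ := h.reach v h.mem
  exact ⟨k + 1, k.succ_pos, hk⟩

/-- `R` is exactly the forward orbit of `v`, one point for each residue modulo the period.
Injectivity of `σ` on `R` is never assumed; it follows from this count. -/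
theorem minimalPeriod_eq (h : OneCycle v R σ) : minimalPeriod σ v = R.card := by
  have hp := minimalPeriod_pos_of_mem_periodicPts h.mem_periodicPts
  have : R = (Finset.range (minimalPeriod σ v)).image fun k => σ^[k] v := by
    ext x
    simp only [Finset.mem_image, Finset.mem_range]
    constructor
    · intro hx
      obtain ⟨k, rfl⟩ := h.reach x hx
      exact ⟨(k + 1) % minimalPeriod σ v, Nat.mod_lt _ hp, iterate_mod_minimalPeriod_eq⟩
    · rintro ⟨k, -, rfl⟩
      exact h.iterate_mem h.mem k
  conv_rhs => rw [this]
  rw [Finset.card_image_of_injOn, Finset.card_range]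
  intro i hi j hj hij
  exact (iterate_eq_iterate_iff_of_lt_minimalPeriod (by simpa using hi) (by simpa using hj)).1 hij

theorem exists_lt (h : OneCycle v R σ) {x : ℕ} (hx : x ∈ R) : ∃ k < R.card, σ^[k] v = x := by
  have hp := minimalPeriod_pos_of_mem_periodicPts h.mem_periodicPts
  obtain ⟨k, rfl⟩ := h.reach x hx
  exact ⟨(k + 1) % minimalPeriod σ v, h.minimalPeriod_eq ▸ Nat.mod_lt _ hp,
    iterate_mod_minimalPeriod_eq⟩

/-- Any point of the cycle may serve as the base point. -/
theorem rebase (h : OneCycle v R σ) {x : ℕ} (hx : x ∈ R) : OneCycle x R σ := by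
  refine ⟨hx, h.mapsTo, fun y hy => ?_⟩
  obtain ⟨i, hi, rfl⟩ := h.exists_lt hx
  obtain ⟨j, hj⟩ := h.reach y hy
  -- Complete the round from `x = σ^[i] v` to `v` in `R.card - i` steps, then take `j + 1` more to
  -- reach `y`.
  refine ⟨j + (R.card - i), ?_⟩
  rw [← iterate_add_apply, ← hj, show j + (R.card - i) + 1 + i = j + 1 + R.card by omega,
    iterate_add_apply, ← h.minimalPeriod_eq, iterate_minimalPeriod]

theorem iterate_inj (h : OneCycle v R σ) {x i j : ℕ} (hx : x ∈ R) (hi : i < R.card)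
    (hj : j < R.card) (hij : σ^[i] x = σ^[j] x) : i = j :=
  (iterate_eq_iterate_iff_of_lt_minimalPeriod ((h.rebase hx).minimalPeriod_eq ▸ hi)
    ((h.rebase hx).minimalPeriod_eq ▸ hj)).1 hij

theorem iterate_card (h : OneCycle v R σ) {x : ℕ} (hx : x ∈ R) : σ^[R.card] x = x := by
  rw [← (h.rebase hx).minimalPeriod_eq, iterate_minimalPeriod]

/-- Insert the new point `u` behind the point `r` of the cycle. -/
theorem insert (h : OneCycle v R σ) {r u : ℕ} (hr : r ∈ R) (hu : u ∉ R) :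
    OneCycle v (insert u R) (update (update σ u (σ r)) r u) := by
  have hru : r ≠ u := fun e => hu (e ▸ hr)
  set σ' := update (update σ u (σ r)) r u with hσ'
  have hr' : σ' r = u := by simp [hσ']
  have hu' : σ' u = σ r := by simp [hσ', hru.symm]
  have hx' : ∀ x ∈ R, x ≠ r → σ' x = σ x := fun x hx hxr => by
    simp [hσ', hxr, show x ≠ u from fun e => hu (e ▸ hx)]
  -- The new orbit follows the old one, except that leaving `r` takes two steps, through `u`.
  have key : ∀ k, ∃ m, σ'^[m] v = σ^[k] v := by
    intro k
    induction k with
    | zero => exact ⟨0, rfl⟩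
    | succ k ih =>
      obtain ⟨m, hm⟩ := ih
      rw [iterate_succ_apply']
      by_cases hk : σ^[k] v = r
      · exact ⟨m + 2, by rw [iterate_succ_apply', iterate_succ_apply', hm, hk, hr', hu']⟩
      · exact ⟨m + 1, by rw [iterate_succ_apply', hm, hx' _ (h.iterate_mem h.mem k) hk]⟩
  have key' : ∀ x ∈ R, ∃ k, σ'^[k + 1] v = x := by
    intro x hx
    obtain ⟨k, rfl⟩ := h.reach x hx
    obtain ⟨m, hm⟩ := key k
    rw [iterate_succ_apply']
    by_cases hk : σ^[k] v = r
    · exact ⟨m + 1, by rw [iterate_succ_apply', iterate_succ_apply', hm, hk, hr', hu']⟩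
    · exact ⟨m, by rw [iterate_succ_apply', hm, hx' _ (h.iterate_mem h.mem k) hk]⟩
  refine ⟨Finset.mem_insert_of_mem h.mem, fun x hx => ?_, fun x hx => ?_⟩
  · rcases Finset.mem_insert.1 hx with rfl | hx
    · rw [hu']; exact Finset.mem_insert_of_mem (h.mapsTo _ hr)
    · by_cases hxr : x = r
      · rw [hxr, hr']; exact Finset.mem_insert_self _ _
      · rw [hx' x hx hxr]; exact Finset.mem_insert_of_mem (h.mapsTo _ hx)
  · rcases Finset.mem_insert.1 hx with rfl | hx
    · obtain ⟨k, hk⟩ := key' r hr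
      exact ⟨k + 1, by rw [iterate_succ_apply', hk, hr']⟩
    · exact key' x hx

end OneCycle

/-- A cyclic order on the set of reached points, as a successor function. -/
@[ext] structure CycConfig where
  next : ℕ → ℕ
  reached : Finset ℕ

namespace CycConfig

/-- For every `r ∈ F` whose image under `f` is not yet reached, insert this image behind `r`. -/
def grow (f : Equiv.Perm ℕ) (F : Finset ℕ) (c : CycConfig) : CycConfig where
  next x :=
    if x ∈ F ∧ f x ∉ c.reached then f x
    else if x ∉ c.reached ∧ f.symm x ∈ F then c.next (f.symm x) else c.next x
  reached := c.reached ∪ F.image f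

/-- Grow along the first `j` permutations of the family `A`. -/
def layer (A : ℕ → Equiv.Perm ℕ) (F : Finset ℕ) (c : CycConfig) : ℕ → CycConfig
  | 0 => c
  | j + 1 => (c.layer A F j).grow (A j) F

/-- `t` rounds of breadth-first search with `d` permutations, starting with the frontier
`c.reached`; the second component is the new frontier. -/
def bfs (A : ℕ → Equiv.Perm ℕ) (d : ℕ) (c : CycConfig) : ℕ → CycConfig × Finset ℕ
  | 0 => (c, c.reached)
  | t + 1 =>
    ((c.bfs A d t).1.layer A (c.bfs A d t).2 d,
      ((c.bfs A d t).1.layer A (c.bfs A d t).2 d).reached \ (c.bfs A d t).1.reached)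

/-- The cycle of `f` through `v`, for points below `n`. -/
noncomputable def start (n : ℕ) (f : Equiv.Perm ℕ) (v : ℕ) : CycConfig := by
  classical exact
  { reached := (Finset.range n).filter fun x => f.SameCycle v x
    next := fun x => if x < n ∧ f.SameCycle v x then f x else x }

theorem grow_empty (f : Equiv.Perm ℕ) (c : CycConfig) : c.grow f ∅ = c := by
  ext <;> simp [grow]

/-- The simultaneous insertion `grow` can be done one point at a time in any order. As `f` is
injective, distinct points of `F` have distinct images, and no new point lies in `F`; hence the
successor of `r` is still the old one when its turn comes. This is how a list in arbitrary queue
order computes something that depends on the set `F` only. -/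
theorem grow_insert {f : Equiv.Perm ℕ} {F : Finset ℕ} {c : CycConfig} {r : ℕ}
    (hF : F ⊆ c.reached) (hr : r ∈ c.reached) (hrF : r ∉ F) :
    c.grow f (insert r F) =
      if f r ∈ (c.grow f F).reached then c.grow f F else
        ⟨update (update (c.grow f F).next (f r) ((c.grow f F).next r)) r (f r),
          insert (f r) (c.grow f F).reached⟩ := by
  have hm : f r ∈ (c.grow f F).reached ↔ f r ∈ c.reached := by
    simp [grow, hrF]
  have hs : ∀ x, f.symm x = r ↔ x = f r := fun x => f.symm_apply_eq
  split_ifs with h <;> rw [hm] at h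
  · ext x
    · simp only [grow, Finset.mem_insert, hs]
      by_cases h1 : x = r
      · subst h1; simp [h, hrF, hr]
      · by_cases h2 : x = f r
        · subst h2; simp [h, h1]
        · simp [h1, h2]
    · simp only [grow, Finset.mem_union, Finset.mem_image, Finset.mem_insert]
      grind
  · have hne : r ≠ f r := fun e => h (e ▸ hr)
    ext x
    · simp only [grow, Finset.mem_insert, update_apply, hs]
      by_cases h1 : x = r
      · subst h1; simp [h]
      · by_cases h2 : x = f r
        · subst h2
          have : f r ∉ F := fun e => h (hF e)
          simp [h, h1, this, hrF, hr]
        · simp [h1, h2]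
    · simp only [grow, Finset.mem_union, Finset.mem_image, Finset.mem_insert]
      grind

/-- `τ` maps the cyclic order `c'` to the cyclic order `c`. -/
structure Conj (τ : Equiv.Perm ℕ) (c c' : CycConfig) : Prop where
  next : ∀ x, c.next (τ x) = τ (c'.next x)
  reached : ∀ x, τ x ∈ c.reached ↔ x ∈ c'.reached

variable {τ : Equiv.Perm ℕ} {c c' : CycConfig} {F F' : Finset ℕ}

/-- The definition of `grow` mentions only membership, `f`, `f.symm` and `next`, all of which `τ`
transports. Nothing in it depends on the names of the points. -/
theorem Conj.grow (h : Conj τ c c') (hF : ∀ x, τ x ∈ F ↔ x ∈ F') {f g : Equiv.Perm ℕ}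
    (hfg : ∀ x, f (τ x) = τ (g x)) : Conj τ (c.grow f F) (c'.grow g F') := by
  have hs : ∀ x, f.symm (τ x) = τ (g.symm x) := fun x => by
    rw [Equiv.symm_apply_eq, hfg, Equiv.apply_symm_apply]
  constructor
  · intro x
    simp only [CycConfig.grow, hF, hfg, h.reached, hs, h.next]
    split_ifs <;> rfl
  · intro x
    simp only [CycConfig.grow, Finset.mem_union, h.reached, Finset.mem_image]
    refine or_congr_right ⟨?_, ?_⟩
    · rintro ⟨y, hy, hyx⟩
      obtain rfl : y = f.symm (τ x) := by rw [← hyx, Equiv.symm_apply_apply]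
      rw [hs, hF] at hy
      exact ⟨_, hy, by simp⟩
    · rintro ⟨y, hy, rfl⟩
      exact ⟨τ y, (hF y).2 hy, hfg y⟩

variable {A B : ℕ → Equiv.Perm ℕ}

theorem Conj.layer (h : Conj τ c c') (hF : ∀ x, τ x ∈ F ↔ x ∈ F')
    (hAB : ∀ j x, A j (τ x) = τ (B j x)) (j : ℕ) :
    Conj τ (c.layer A F j) (c'.layer B F' j) := by
  induction j with
  | zero => exact h
  | succ j ih => exact ih.grow hF (hAB j)

theorem Conj.bfs (h : Conj τ c c') (hAB : ∀ j x, A j (τ x) = τ (B j x)) (d t : ℕ) :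
    Conj τ (c.bfs A d t).1 (c'.bfs B d t).1 ∧
      ∀ x, τ x ∈ (c.bfs A d t).2 ↔ x ∈ (c'.bfs B d t).2 := by
  induction t with
  | zero => exact ⟨h, h.reached⟩
  | succ t ih =>
    have := ih.1.layer ih.2 hAB d
    refine ⟨this, fun x => ?_⟩
    simp only [CycConfig.bfs, Finset.mem_sdiff, this.reached, ih.1.reached]

theorem layer_empty (c : CycConfig) (j : ℕ) : c.layer A ∅ j = c := by
  induction j with
  | zero => rfl
  | succ j ih => rw [layer, ih, grow_empty]

theorem bfs_add_of_empty {d t : ℕ} (h : (c.bfs A d t).2 = ∅) (s : ℕ) :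
    c.bfs A d (t + s) = c.bfs A d t := by
  induction s with
  | zero => rfl
  | succ s ih =>
    rw [← add_assoc, bfs, ih, h, layer_empty, Finset.sdiff_self, Prod.ext_iff]
    exact ⟨rfl, h.symm⟩

/-- Two searches that have ended have conjugate results if they start conjugate. -/
theorem Conj.bfs_of_empty (h : Conj τ c c') (hAB : ∀ j x, A j (τ x) = τ (B j x)) {d t t' : ℕ}
    (ht : (c.bfs A d t).2 = ∅) (ht' : (c'.bfs B d t').2 = ∅) :
    Conj τ (c.bfs A d t).1 (c'.bfs B d t').1 := by
  -- A finished search is stationary, so both are compared after the common number `t + t'` of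
  -- rounds.
  rw [← bfs_add_of_empty ht t', ← bfs_add_of_empty ht' t, add_comm t' t]
  exact (h.bfs hAB d (t + t')).1

/-- The base points need not correspond: it suffices that `τ u` lies on the cycle of `v`. Hence one
trial per cycle of the second tuple is enough. -/
theorem Conj.start {n : ℕ} {f g : Equiv.Perm ℕ} {v u : ℕ} (hτ : ∀ x, τ x < n ↔ x < n)
    (hfg : ∀ x, f (τ x) = τ (g x)) (hv : f.SameCycle v (τ u)) :
    Conj τ (start n f v) (start n g u) := by
  have hf : f = τ * g * τ⁻¹ := by
    ext x
    simpa using hfg (τ⁻¹ x)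
  have key : ∀ x, f.SameCycle v (τ x) ↔ g.SameCycle u x := fun x => by
    have h1 : f.SameCycle (τ u) (τ x) ↔ g.SameCycle u x := by
      rw [hf, Equiv.Perm.sameCycle_conj]; simp
    rw [← h1]
    exact ⟨fun h => hv.symm.trans h, fun h => hv.trans h⟩
  constructor
  · intro x
    simp only [CycConfig.start, hτ, key, hfg]
    by_cases hx : x < n ∧ g.SameCycle u x
    · rw [if_pos hx, if_pos (by rwa [hτ, key])]
    · rw [if_neg hx, if_neg (by rwa [hτ, key])]
  · intro x
    simp [CycConfig.start, hτ, key]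

end CycConfig

/-! ## Comparing two periodic words up to a cyclic shift -/

section Shift
variable {L : Type*} [LinearOrder L]

/-- The word `f` without its first `i` letters, with the lexicographic order. -/
def shift (f : ℕ → L) (i : ℕ) : Lex (ℕ → L) := toLex fun k => f (i + k)

/-- Every shift of `f` by less than `i` is larger than some shift of `g`. -/
def ShiftsBeaten (f g : ℕ → L) (i : ℕ) : Prop := ∀ i' < i, ∃ j', shift g j' < shift f i'

theorem ShiftsBeaten.zero (f g : ℕ → L) : ShiftsBeaten f g 0 := fun _ h => absurd h (by omega)

/-- If `f` from `i` and `g` from `j` agree for `k` letters and then `g` is smaller, dropping the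
first `m ≤ k` letters of both leaves a strict inequality with the same witness. Thus one mismatch
disposes of `k + 1` shifts. -/
theorem ShiftsBeaten.add {f g : ℕ → L} {i j k : ℕ} (h : ShiftsBeaten f g i)
    (heq : ∀ k' < k, f (i + k') = g (j + k')) (hlt : g (j + k) < f (i + k)) :
    ShiftsBeaten f g (i + (k + 1)) := by
  intro i' hi'
  by_cases hi : i' < i
  · exact h i' hi
  · obtain ⟨m, rfl⟩ := Nat.exists_eq_add_of_le (not_lt.1 hi)
    refine ⟨j + m, k - m, fun k' hk' => ?_, ?_⟩
    · have := heq (m + k') (by omega)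
      simp only [shift, Pi.toLex_apply, add_assoc, this]
    · simp only [shift, Pi.toLex_apply, add_assoc, show m + (k - m) = k by omega, hlt]

/-- Equivalent periodic words have the same shifts, so a minimal shift of `f` is not beaten by any
shift of `g`. It occurs at an index below `n`, which therefore bounds `i`. -/
theorem ShiftsBeaten.lt_of_shift_eq {f g : ℕ → L} {n i i₀ j₀ : ℕ} (hn : 0 < n)
    (hf : ∀ k, f (k + n) = f k) (hg : ∀ k, g (k + n) = g k)
    (heq : ∀ k, f (i₀ + k) = g (j₀ + k)) (h : ShiftsBeaten f g i) : i < n := by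
  have per : ∀ {f : ℕ → L}, (∀ k, f (k + n) = f k) → ∀ m k, f (k + n * m) = f k := by
    intro f hf m k
    induction m with
    | zero => rfl
    | succ m ih => rw [Nat.mul_succ, ← add_assoc, hf, ih]
  by_contra! hni
  obtain ⟨i₁, hi₁, hmin⟩ := Finset.exists_min_image (Finset.range n) (shift f)
    ⟨0, Finset.mem_range.2 hn⟩
  rw [Finset.mem_range] at hi₁
  obtain ⟨j', hj'⟩ := h i₁ (by omega)
  have hj₀ : j₀ ≤ n * j₀ := Nat.le_mul_of_pos_left _ hn
  -- The summand `n * j₀` is a multiple of the period that keeps the subtraction of `j₀` from being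
  -- cut off.
  have h1 : shift g j' = shift f ((i₀ + (j' + n * j₀ - j₀)) % n) := by
    refine congrArg toLex (funext fun k => ?_)
    set e := i₀ + (j' + n * j₀ - j₀) with he
    have h2 := per hf (e / n) (e % n + k)
    rw [show e % n + k + n * (e / n) = e + k by have := Nat.mod_add_div e n; omega] at h2
    rw [← h2, he, add_assoc, heq, ← per hg j₀ (j' + k)]
    congr 1
    omega
  exact absurd (hmin _ (Finset.mem_range.2 (Nat.mod_lt _ hn))) (by rw [← h1]; exact not_le.2 hj')

end Shift

/-! ## Permutations relative to a cyclic order -/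

/-- `τ` is a permutation of `{0, …, n - 1}` which conjugates the family `A` to the family `B`. -/
structure IsIso (n : ℕ) (A B : ℕ → Equiv.Perm ℕ) (τ : Equiv.Perm ℕ) : Prop where
  lt_iff : ∀ x, τ x < n ↔ x < n
  comm : ∀ j x, A j (τ x) = τ (B j x)

/-- The permutations `A l` with `l < d` are given by their displacements `S · l` along the cyclic
order `σ` of `{0, …, n - 1}`. -/
structure Displacement (n d : ℕ) (A : ℕ → Equiv.Perm ℕ) (v : ℕ) (σ : ℕ → ℕ) (S : ℕ → ℕ → ℕ) :
    Prop where
  cycle : OneCycle v (Finset.range n) σ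
  lt : ∀ x < n, ∀ l < d, S x l < n
  eq : ∀ x < n, ∀ l < d, σ^[S x l] x = A l x

/-- The displacements at the points of a cyclic order, as a word. -/
def dispWord (d v : ℕ) (σ : ℕ → ℕ) (S : ℕ → ℕ → ℕ) (k : ℕ) : Lex (ℕ → ℕ) :=
  toLex fun l => if l < d then S (σ^[k] v) l else 0

theorem dispWord_eq {d v v' i i' : ℕ} {σ σ' : ℕ → ℕ} {S S' : ℕ → ℕ → ℕ}
    (h : ∀ l < d, S (σ^[i] v) l = S' (σ'^[i'] v') l) :
    dispWord d v σ S i = dispWord d v' σ' S' i' := by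
  refine congrArg toLex (funext fun l => ?_)
  split_ifs with hl
  · exact h l hl
  · rfl

theorem apply_eq_of_dispWord_eq {d v v' i i' : ℕ} {σ σ' : ℕ → ℕ} {S S' : ℕ → ℕ → ℕ}
    (h : dispWord d v σ S i = dispWord d v' σ' S' i') {l : ℕ} (hl : l < d) :
    S (σ^[i] v) l = S' (σ'^[i'] v') l := by
  have := congrFun (congrArg ofLex h) l
  simpa [dispWord, hl] using this

theorem dispWord_lt {d v v' i i' l : ℕ} {σ σ' : ℕ → ℕ} {S S' : ℕ → ℕ → ℕ} (hl : l < d)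
    (heq : ∀ l' < l, S (σ^[i] v) l' = S' (σ'^[i'] v') l')
    (hlt : S (σ^[i] v) l < S' (σ'^[i'] v') l) :
    dispWord d v σ S i < dispWord d v' σ' S' i' := by
  refine ⟨l, fun l' hl' => ?_, ?_⟩
  · simp only [dispWord, Pi.toLex_apply, hl'.trans hl, if_true, heq l' hl']
  · simpa only [dispWord, Pi.toLex_apply, hl, if_true] using hlt

namespace Displacement
variable {n d v v' : ℕ} {A B : ℕ → Equiv.Perm ℕ} {σ σ' : ℕ → ℕ} {S S' : ℕ → ℕ → ℕ}

theorem iterate_lt (h : Displacement n d A v σ S) {x : ℕ} (hx : x < n) (k : ℕ) :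
    σ^[k] x < n := by
  simpa using h.cycle.iterate_mem (x := x) (by simpa using hx) k

theorem root_lt (h : Displacement n d A v σ S) : v < n := by simpa using h.cycle.mem

theorem dispWord_add (h : Displacement n d A v σ S) (k : ℕ) :
    dispWord d v σ S (k + n) = dispWord d v σ S k := by
  have := h.cycle.iterate_card h.cycle.mem
  rw [Finset.card_range] at this
  rw [dispWord, iterate_add_apply, this, dispWord]

/-- Equal displacements at corresponding points give an isomorphism. -/
theorem exists_isIso (h : Displacement n d A v σ S) (h' : Displacement n d B v' σ' S')
    (hA : ∀ j x, d ≤ j ∨ n ≤ x → A j x = x) (hB : ∀ j x, d ≤ j ∨ n ≤ x → B j x = x) {i j : ℕ}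
    (heq : ∀ k < n, dispWord d v σ S (i + k) = dispWord d v' σ' S' (j + k)) :
    ∃ τ, IsIso n A B τ := by
  set x := σ^[i] v with hx
  set y := σ'^[j] v' with hy
  have hxn : x < n := h.iterate_lt h.root_lt i
  have hyn : y < n := h'.iterate_lt h'.root_lt j
  have hcx := h.cycle.rebase (x := x) (by simpa using hxn)
  have hcy := h'.cycle.rebase (x := y) (by simpa using hyn)
  have hidx : ∀ z, ∃ k, z < n → k < n ∧ σ'^[k] y = z := fun z => by
    by_cases hz : z < n
    · obtain ⟨k, hk, hkz⟩ := hcy.exists_lt (by simpa using hz)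
      exact ⟨k, fun _ => ⟨by simpa using hk, hkz⟩⟩
    · exact ⟨0, fun h => absurd h hz⟩
  choose idx hidx using hidx
  -- The candidate matches the two cyclic orders, sending the `k`-th point after `y` to the `k`-th
  -- point after `x`, and fixes everything from `n` on.
  set t : ℕ → ℕ := fun z => if z < n then σ^[idx z] x else z with ht
  have ht1 : ∀ k, t (σ'^[k] y) = σ^[k] x := by
    have ht0 : ∀ k < n, t (σ'^[k] y) = σ^[k] x := fun k hk => by
      have hz := h'.iterate_lt hyn k
      obtain ⟨h1, h2⟩ := hidx _ hz
      rw [ht]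
      simp only [hz, if_true]
      rw [hcy.iterate_inj hcy.mem (by simpa using h1) (by simpa using hk) h2]
    have hmod : ∀ {f : ℕ → ℕ} {z : ℕ}, OneCycle z (Finset.range n) f →
        ∀ k, f^[k % n] z = f^[k] z := fun {f z} hf k => by
      have := iterate_mod_minimalPeriod_eq (f := f) (x := z) (n := k)
      rwa [hf.minimalPeriod_eq, Finset.card_range] at this
    intro k
    rw [← hmod hcy, ← hmod hcx, ht0 _ (Nat.mod_lt _ (by omega))]
  have ht2 : ∀ z, n ≤ z → t z = z := fun z hz => by simp [ht, hz]
  have ht3 : ∀ z, t z < n ↔ z < n := fun z => by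
    by_cases hz : z < n
    · simp only [ht, hz, if_true, iff_true]; exact h.iterate_lt hxn _
    · rw [ht2 z (by omega)]
  have hbij : Bijective t := by
    constructor
    · intro z z' hzz
      by_cases hz : z < n
      · have hz' : z' < n := by rwa [← ht3, ← hzz, ht3]
        simp only [ht, hz, hz', if_true] at hzz
        rw [← (hidx z hz).2, ← (hidx z' hz').2]
        rw [hcx.iterate_inj hcx.mem (by simpa using (hidx z hz).1)
          (by simpa using (hidx z' hz').1) hzz]
      · have hz' : ¬ z' < n := by rwa [← ht3, ← hzz, ht3]
        rwa [ht2 z (by omega), ht2 z' (by omega)] at hzz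
    · intro z
      by_cases hz : z < n
      · obtain ⟨k, -, rfl⟩ := hcx.exists_lt (by simpa using hz)
        exact ⟨_, ht1 k⟩
      · exact ⟨z, ht2 z (by omega)⟩
  refine ⟨Equiv.ofBijective t hbij, ht3, fun l z => ?_⟩
  simp only [Equiv.ofBijective_apply]
  by_cases hl : d ≤ l
  · rw [hA l _ (.inl hl), hB l _ (.inl hl)]
  by_cases hz : n ≤ z
  · rw [hB l z (.inr hz), ht2 z hz, hA l z (.inr hz)]
  obtain ⟨hk, hkz⟩ := hidx z (by omega)
  -- Corresponding points have equal displacements, so their images are again corresponding points.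
  have hd := apply_eq_of_dispWord_eq (heq _ hk) (l := l) (by omega)
  rw [add_comm i, add_comm j, iterate_add_apply, iterate_add_apply, ← hx, ← hy, hkz] at hd
  have htz : t z = σ^[idx z] x := by simp [ht, show z < n by omega]
  rw [htz, ← h.eq _ (h.iterate_lt hxn _) l (by omega), ← h'.eq z (by omega) l (by omega), hd,
    ← iterate_add_apply, ← ht1, iterate_add_apply, hkz]

/-- An isomorphism which respects the cyclic orders gives equal displacements. -/
theorem dispWord_eq_of_isIso (h : Displacement n d A v σ S) (h' : Displacement n d B v' σ' S')
    {τ : Equiv.Perm ℕ} (hτ : IsIso n A B τ) (hσ : ∀ x, σ (τ x) = τ (σ' x)) :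
    ∃ i, ∀ k, dispWord d v σ S (i + k) = dispWord d v' σ' S' (0 + k) := by
  have hit : ∀ k x, σ^[k] (τ x) = τ (σ'^[k] x) := fun k x => by
    induction k with
    | zero => rfl
    | succ k ih => rw [iterate_succ_apply', ih, hσ, iterate_succ_apply']
  obtain ⟨i, -, hi⟩ := h.cycle.exists_lt (x := τ v')
    (by simpa [hτ.lt_iff] using h'.root_lt)
  refine ⟨i, fun k => dispWord_eq fun l hl => ?_⟩
  have hz := h'.iterate_lt h'.root_lt k
  rw [zero_add, add_comm, iterate_add_apply, hi, hit]
  have hτz := (hτ.lt_iff _).2 hz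
  -- Both displacements lead from the same point to the same image and are below `n`, so they are
  -- equal.
  refine h.cycle.iterate_inj (x := τ (σ'^[k] v')) (by simpa using hτz)
    (by simpa using h.lt _ hτz l hl) (by simpa using h'.lt _ hz l hl) ?_
  rw [h.eq _ hτz l hl, hit, h'.eq _ hz l hl, hτ.comm]

end Displacement

/-! ### Cycles of permutations of `ℕ` that fix all points from `n` on -/

theorem Equiv.Perm.apply_lt_of_fixes {n : ℕ} {f : Equiv.Perm ℕ} (hf : ∀ x, n ≤ x → f x = x)
    {x : ℕ} (hx : x < n) : f x < n := by
  by_contra! h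
  have := f.injective (hf _ h)
  omega

/-- Pigeonhole on the first `n + 1` iterates, then cancellation by injectivity. -/
theorem Equiv.Perm.mem_periodicPts_of_fixes {n : ℕ} {f : Equiv.Perm ℕ}
    (hf : ∀ x, n ≤ x → f x = x) (x : ℕ) : x ∈ periodicPts f := by
  rcases le_or_gt n x with hx | hx
  · exact ⟨1, one_pos, hf x hx⟩
  · have hlt : ∀ k, f^[k] x < n := fun k => by
      induction k with
      | zero => exact hx
      | succ k ih => rw [iterate_succ_apply']; exact f.apply_lt_of_fixes hf ih
    obtain ⟨i, -, j, -, hij, he⟩ := Finset.exists_ne_map_eq_of_card_lt_of_maps_to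
      (s := Finset.range (n + 1)) (t := Finset.range n) (by simp)
      (f := fun k => f^[k] x) (fun k _ => by simpa using hlt k)
    have key : ∀ i j, i < j → f^[i] x = f^[j] x → x ∈ periodicPts f := fun i j h he =>
      ⟨j - i, by omega, f.injective.iterate i (by
        rw [← iterate_add_apply, show i + (j - i) = j by omega, ← he])⟩
    rcases lt_or_gt_of_ne hij with h | h
    · exact key i j h he
    · exact key j i h he.symm

theorem Equiv.Perm.sameCycle_iff_exists_iterate {f : Equiv.Perm ℕ} {v x : ℕ}
    (hv : v ∈ periodicPts f) : f.SameCycle v x ↔ ∃ k < minimalPeriod f v, f^[k] v = x := by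
  have hp := minimalPeriod_pos_of_mem_periodicPts hv
  constructor
  · rintro ⟨z, rfl⟩
    set P := minimalPeriod f v with hP
    have h1 : (f ^ P) v = v := by
      rw [← Equiv.Perm.iterate_eq_pow]; exact iterate_minimalPeriod
    have h2 := Equiv.Perm.zpow_apply_eq_self_of_apply_eq_self h1 (z / P)
    obtain ⟨m, hm⟩ := Int.eq_ofNat_of_zero_le (Int.emod_nonneg z (b := P) (by omega))
    have hlt := Int.emod_lt_of_pos z (b := P) (by omega)
    refine ⟨m, by omega, ?_⟩
    conv_rhs => rw [← Int.emod_add_mul_ediv z P, zpow_add, zpow_mul, Equiv.Perm.mul_apply,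
      zpow_natCast, h2, hm, zpow_natCast]
    rw [Equiv.Perm.iterate_eq_pow]
  · rintro ⟨k, -, rfl⟩
    exact ⟨k, by rw [zpow_natCast, Equiv.Perm.iterate_eq_pow]⟩

/-! ### Walking along a cycle on the machine -/

namespace WordRAM

/-- Mark the cycle of the point `reg i` under the permutation in row `reg j` of segment `kT`, in
segment `kV`; register `11` counts the points that were not marked before. -/
def walk (kT kV j i : ℕ) : Prog :=
  .seq (.copy 10 i) (.seq (.const 11 0) (.seq (.load 12 kV j 10)
    (.loop (.eq 12 3)
      (.seq (.store kV j 10 2) (.seq (.load 10 kT j 10) (.seq (.op .add 11 11 2)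
        (.load 12 kV j 10)))))))

/-- The set `V` is marked in row `j` of segment `k`. -/
def Marks (n k j : ℕ) (V : Finset ℕ) (s : State) : Prop :=
  ∀ x < n, s.mem k j x = if x ∈ V then 1 else 0

/-- Since `V` is a union of cycles, the walk either stops at once or goes around a whole unmarked
cycle until it meets its starting point. The cost is charged to the newly marked points, so that
walking from every point in turn is linear in `n`. -/
theorem wp_walk {w n kT kV j i jv iv : ℕ} {f : Equiv.Perm ℕ} {V : Finset ℕ} {s : State}
    (hn : n < 2 ^ w) (hf : ∀ x, n ≤ x → f x = x)
    (hV : V ⊆ Finset.range n) (hfV : ∀ x, f x ∈ V ↔ x ∈ V) (hk : kT ≠ kV)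
    (hj : j ∉ [10, 11, 12])
    (h2 : s.reg 2 = 1) (h3 : s.reg 3 = 0) (hjv : s.reg j = jv) (hiv : s.reg i = iv) (hin : iv < n)
    (hT : ∀ x < n, s.mem kT jv x = f x) (hM : Marks n kV jv V s) :
    WP w (walk kT kV j i) (fun t s' => t ≤ 5 * s'.reg 11 + 4 ∧
      (∀ j' ≠ jv, s'.mem kV j' = s.mem kV j') ∧
      ∃ V' ⊆ Finset.range n, (∀ x, f x ∈ V' ↔ x ∈ V') ∧ Marks n kV jv V' s' ∧
        V'.card = V.card + s'.reg 11 ∧ (∀ x, x ∈ V' ↔ x ∈ V ∨ f.SameCycle iv x) ∧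
        s'.reg 11 = if iv ∈ V then 0 else minimalPeriod f iv) s := by
  have hper := f.mem_periodicPts_of_fixes hf iv
  have hppos := minimalPeriod_pos_of_mem_periodicPts hper
  have hlt : ∀ k, f^[k] iv < n := fun k => by
    induction k with
    | zero => exact hin
    | succ k ih => rw [iterate_succ_apply']; exact f.apply_lt_of_fixes hf ih
  have hw : 1 < 2 ^ w := by omega
  simp only [List.mem_cons, List.not_mem_nil, not_or, or_false] at hj
  have hwit : ∀ k, f^[k] iv % 2 ^ w = f^[k] iv := fun k =>
    Nat.mod_eq_of_lt ((hlt k).trans hn)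
  rw [walk, wp_seq, wp_copy, wp_seq, wp_const, wp_seq, wp_load]
  set W : ℕ → Finset ℕ := fun m => V ∪ (Finset.range m).image fun k => f^[k] iv with hW
  have hW1 : ∀ m, W (m + 1) = insert (f^[m] iv) (W m) := fun m => by
    simp [hW, Finset.range_add_one]
  have hWn : ∀ m, W m ⊆ Finset.range n := fun m => Finset.union_subset hV fun x hx => by
    obtain ⟨k, -, rfl⟩ := Finset.mem_image.1 hx
    simpa using hlt k
  have hVit : ∀ m, f^[m] iv ∈ V ↔ iv ∈ V := fun m => by
    induction m with
    | zero => rfl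
    | succ m ih => rw [iterate_succ_apply', hfV, ih]
  refine WP.mono (wp_loop
    (fun φ s' => ∃ m, φ + 5 * (W m).card = 5 * n ∧ (W m).card = V.card + m ∧ s'.reg 11 = m ∧
      s'.reg 10 = f^[m] iv ∧ s'.reg 12 = (if f^[m] iv ∈ W m then 1 else 0) ∧
      Marks n kV jv (W m) s' ∧ (∀ j' ≠ jv, s'.mem kV j' = s.mem kV j') ∧
      (iv ∉ V → m ≤ minimalPeriod f iv)) (φ := 5 * n - 5 * V.card) ?_ ?_) ?_
  · have hc := Finset.card_le_card hV
    rw [Finset.card_range] at hc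
    refine ⟨0, ?_, ?_, ?_, ?_, ?_, ?_, ?_, ?_⟩
    · simp [hW]; omega
    · simp [hW]
    · simp
    · simp [hiv, Nat.mod_eq_of_lt (hin.trans hn)]
    · have := hM iv hin
      simp [hj, hiv, hjv, hW, Nat.mod_eq_of_lt (hin.trans hn), this]
      split_ifs <;> simp [Nat.mod_eq_of_lt hw]
    · simpa [hW, Marks] using hM
    · simp
    · simp
  · rintro φ s' ⟨m, hφ, hcard, h11, h10, h12, hM', hrow, hle⟩ hfr hc
    have hs' : ∀ x ∉ [10, 11, 12], s'.reg x = s.reg x := fun x hx => by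
      simp only [List.mem_cons, List.not_mem_nil, not_or, or_false] at hx
      rw [hfr.reg x (by simp [Prog.regs, hx])]
      simp [hx]
    have hj' : s'.reg j = jv := by rw [hs' j (by simp [hj]), hjv]
    have h2' : s'.reg 2 = 1 := by rw [hs' 2 (by simp), h2]
    have hT' : s'.mem kT = s.mem kT := by rw [hfr.mem kT (by simp [Prog.segs, hk])]; simp
    have hnot : f^[m] iv ∉ W m := fun h => by
      simp [Test.Holds, h12, h, hs' 3, h3] at hc
    have hcard' : (W (m + 1)).card = (W m).card + 1 := by
      rw [hW1, Finset.card_insert_of_notMem hnot]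
    have hle' := Finset.card_le_card (hWn (m + 1))
    rw [Finset.card_range] at hle'
    have hmw : m + 1 < 2 ^ w := by omega
    have hfm : f (f^[m] iv) = f^[m + 1] iv := (iterate_succ_apply' _ _ _).symm
    have hM1 : ∀ x < n, (s'.setMem kV jv (f^[m] iv) 1).mem kV jv x =
        if x ∈ W (m + 1) then 1 else 0 := fun x hx => by
      rw [setMem_mem, hM' x hx, hW1]
      by_cases hxm : x = f^[m] iv <;> simp [hxm]
    have hM2 := hM1 _ (hlt (m + 1))
    simp only [setMem_mem, true_and] at hM1 hM2
    simp only [wp_seq, wp_store, wp_load, wp_op, setReg_reg, setMem_reg, setReg_mem, hj', h10, h2',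
      hj, if_false, if_true, setMem_mem, hk, false_and, hT', hT _ (hlt m), hfm, hwit, h11,
      Op.eval, Nat.reduceEqDiff, Nat.mod_eq_of_lt hmw]
    refine ⟨φ - 5, by omega, m + 1, by omega, by omega, ?_, ?_, ?_, ?_, ?_, ?_⟩
    · rfl
    · rfl
    · simp only [true_and, hM2]
      split_ifs <;> simp [Nat.mod_eq_of_lt hw]
    · intro x hx
      simpa using hM1 x hx
    · intro j' hj''
      ext x
      simp [hj'', hrow j' hj'']
    -- The walk cannot go past one full period: `f^[m] iv` would then be `iv`, which is already
    -- marked.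
    · intro hiV
      have := hle hiV
      refine Nat.succ_le_of_lt (lt_of_le_of_ne this fun he => hnot ?_)
      rw [he, iterate_minimalPeriod]
      exact Finset.mem_union_right _ (Finset.mem_image.2 ⟨0, by simp; omega, rfl⟩)
  · rintro t s' ⟨hc, φ, ht, m, hφ, hcard, h11, h10, h12, hM', hrow, hle⟩ hfr
    have h3' : s'.reg 3 = 0 := by rw [hfr.reg 3 (by simp [Prog.regs])]; simp [h3]
    have hmem : f^[m] iv ∈ W m := by
      by_contra h
      simp [Test.Holds, h12, h, h3'] at hc
    have hm : m = if iv ∈ V then 0 else minimalPeriod f iv := by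
      split_ifs with h
      · by_contra h0
        have h1 : W 1 = W 0 := by simp [hW, h]
        have : W m ⊆ V ∪ (Finset.range m).image fun k => f^[k] iv := subset_rfl
        have h2 : W m ⊆ V := Finset.union_subset subset_rfl fun x hx => by
          obtain ⟨k, -, rfl⟩ := Finset.mem_image.1 hx
          exact (hVit k).2 h
        have := Finset.card_le_card h2
        omega
      · refine le_antisymm (hle h) (not_lt.1 fun hlt' => ?_)
        rcases Finset.mem_union.1 hmem with h' | h'
        · exact h ((hVit m).1 h')
        · obtain ⟨k, hk, he⟩ := Finset.mem_image.1 h'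
          rw [Finset.mem_range] at hk
          have := (iterate_eq_iterate_iff_of_lt_minimalPeriod (by omega) hlt').1 he
          omega
    have hWm : ∀ x, x ∈ W m ↔ x ∈ V ∨ f.SameCycle iv x := fun x => by
      rw [Equiv.Perm.sameCycle_iff_exists_iterate hper, hW, Finset.mem_union, Finset.mem_image]
      simp only [Finset.mem_range]
      split_ifs at hm with h
      · refine ⟨by rintro (h | ⟨k, hk, -⟩); exacts [.inl h, by omega], ?_⟩
        rintro (h' | ⟨k, -, rfl⟩)
        exacts [.inl h', .inl ((hVit k).2 h)]
      · rw [← hm]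
    rw [h11]
    refine ⟨by omega, hrow, W m, hWn m, fun x => ?_, hM', hcard, hWm, hm⟩
    rw [hWm, hWm, hfV, Equiv.Perm.sameCycle_apply_right]
end WordRAM

/-! ### Growing the cyclic order on the machine -/

namespace WordRAM

/-- One pass over the entries `reg 14, …, reg 15 - 1` of the queue in segment `6`: for every entry
`r` whose image `u` under the permutation in row `reg 17` of segment `k` is not marked, insert `u`
behind `r` in the list with successors in segment `2 + k`, and append it to the queue. -/
def growPass (k : ℕ) : Prog :=
  .seq (.copy 18 14) (.loop (.lt 18 15)
    (.seq (.load 19 6 18 18) (.seq (.load 20 k 17 19) (.seq (.load 21 8 20 20)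
      (.seq (.ite (.eq 21 3)
        (.seq (.store 8 20 20 2) (.seq (.store 6 16 16 20) (.seq (.op .add 16 16 2)
          (.seq (.load 21 (2 + k) 19 19) (.seq (.store (2 + k) 20 20 21)
            (.store (2 + k) 19 19 20))))))
        .skip)
      (.op .add 18 18 2))))))

/-- The memory holds the cyclic order `c` of a set of points below `n`, with a list of these
points in the queue. -/
structure HoldsCyc (n k v : ℕ) (c : CycConfig) (s : State) : Prop where
  next : ∀ x < n, s.mem (2 + k) x x = c.next x
  mark : ∀ x < n, s.mem 8 x x = if x ∈ c.reached then 1 else 0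
  queue : c.reached = (Finset.range c.reached.card).image fun p => s.mem 6 p p
  len : s.reg 16 = c.reached.card
  sub : c.reached ⊆ Finset.range n
  cycle : OneCycle v c.reached c.next

theorem HoldsCyc.card_le {n k v : ℕ} {c : CycConfig} {s : State} (h : HoldsCyc n k v c s) :
    c.reached.card ≤ n := by
  simpa using Finset.card_le_card h.sub

theorem HoldsCyc.queue_mem {n k v p : ℕ} {c : CycConfig} {s : State} (h : HoldsCyc n k v c s)
    (hp : p < c.reached.card) : s.mem 6 p p ∈ c.reached := by
  rw [h.queue]
  exact Finset.mem_image.2 ⟨p, by simpa using hp, rfl⟩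

theorem HoldsCyc.queue_inj {n k v p q : ℕ} {c : CycConfig} {s : State} (h : HoldsCyc n k v c s)
    (hp : p < c.reached.card) (hq : q < c.reached.card) (he : s.mem 6 p p = s.mem 6 q q) :
    p = q := by
  have : Set.InjOn (fun p => s.mem 6 p p) (Finset.range c.reached.card) := by
    rw [← Finset.card_image_iff, ← h.queue, Finset.card_range]
  exact this (by simpa using hp) (by simpa using hq) he

/-- The tables of the permutations `A j` with `j < d` are stored in segment `k`. -/
def Tabulated (n d k : ℕ) (A : ℕ → Equiv.Perm ℕ) (s : State) : Prop :=
  ∀ j < d, ∀ x < n, s.mem k j x = A j x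

/-- `CycConfig.grow_insert` is the loop step. The frontier is a segment of the queue lying below the
old length, so appending does not disturb it. -/
theorem wp_growPass {w n k v lo hi : ℕ} {f : Equiv.Perm ℕ} {c : CycConfig} {s : State}
    (hn : n < 2 ^ w) (hk : k < 2) (hf : ∀ x, n ≤ x → f x = x) (h2 : s.reg 2 = 1) (h3 : s.reg 3 = 0)
    (hlo : s.reg 14 = lo) (hhi : s.reg 15 = hi) (hlh : lo ≤ hi)
    (hT : ∀ x < n, s.mem k (s.reg 17) x = f x) (hc : HoldsCyc n k v c s)
    (hic : hi ≤ c.reached.card) :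
    WP w (growPass k) (fun t s' => t ≤ 13 * (hi - lo) + 2 ∧
      HoldsCyc n k v (c.grow f ((Finset.Ico lo hi).image fun p => s.mem 6 p p)) s' ∧
      ∀ p < c.reached.card, s'.mem 6 p p = s.mem 6 p p) s := by
  have hv : v < n := by simpa using hc.sub hc.cycle.mem
  have hw : 1 < 2 ^ w := by omega
  have hcn := hc.card_le
  rw [growPass, wp_seq, wp_copy, hlo]
  set Q : ℕ → ℕ := fun p => s.mem 6 p p with hQ
  refine WP.mono (wp_loop (fun φ s' => ∃ q, lo ≤ q ∧ q ≤ hi ∧ s'.reg 18 = q ∧ φ = 13 * (hi - q) ∧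
    HoldsCyc n k v (c.grow f ((Finset.Ico lo q).image Q)) s' ∧
      ∀ p < c.reached.card, s'.mem 6 p p = Q p) (φ := 13 * (hi - lo)) ?_ ?_) ?_
  · refine ⟨lo, le_rfl, hlh, by simp [Nat.mod_eq_of_lt (show lo < 2 ^ w by omega)], rfl, ?_, ?_⟩
    · simp only [Finset.Ico_self, Finset.image_empty, CycConfig.grow_empty]
      exact ⟨hc.next, hc.mark, hc.queue, by simp [hc.len], hc.sub, hc.cycle⟩
    · simp [hQ]
  · rintro φ s' ⟨q, hloq, hqhi, h18, rfl, hs, hQs⟩ hfr hlt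
    have hreg : ∀ x ∉ [16, 18, 19, 20, 21], s'.reg x = s.reg x := fun x hx => by
      simp only [List.mem_cons, List.not_mem_nil, not_or, or_false] at hx
      rw [hfr.reg x (by simp [Prog.regs, hx])]
      simp [hx]
    have hT' : s'.mem k = s.mem k := by
      rw [hfr.mem k (by simp [Prog.segs]; omega)]; simp
    simp only [Test.Holds, h18, hreg 15 (by simp), hhi] at hlt
    have hrc : Q q ∈ c.reached := hc.queue_mem (by omega)
    have hrF : Q q ∉ (Finset.Ico lo q).image Q := by
      simp only [Finset.mem_image, Finset.mem_Ico, not_exists, not_and]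
      intro p hp he
      have := hc.queue_inj (by omega) (by omega) he
      omega
    have hFc : (Finset.Ico lo q).image Q ⊆ c.reached := by
      intro x hx
      obtain ⟨p, hp, rfl⟩ := Finset.mem_image.1 hx
      rw [Finset.mem_Ico] at hp
      exact hc.queue_mem (by omega)
    have hins : (Finset.Ico lo (q + 1)).image Q = insert (Q q) ((Finset.Ico lo q).image Q) := by
      rw [← Finset.image_insert]
      congr 1
      ext x
      simp only [Finset.mem_Ico, Finset.mem_insert]
      omega
    have hgrow := CycConfig.grow_insert (f := f) hFc hrc hrF
    rw [← hins] at hgrow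
    set c₁ := c.grow f ((Finset.Ico lo q).image Q) with hc₁
    have hrc₁ : Q q ∈ c₁.reached := Finset.mem_union_left _ hrc
    have hr : Q q < n := by simpa using hc.sub hrc
    have hu := f.apply_lt_of_fixes hf hr
    set r := Q q with hr_def
    have hcard := hs.card_le
    have hnext : c₁.next r < n := by simpa using hs.sub (hs.cycle.mapsTo _ hrc₁)
    have e16 := hs.len
    have e3 : s'.reg 3 = 0 := by rw [hreg 3 (by simp), h3]
    have e2 : s'.reg 2 = 1 := by rw [hreg 2 (by simp), h2]
    have eT : s'.mem k (s.reg 17) r = f r := by rw [hT', hT _ hr]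
    have m1 : r % 2 ^ w = r := Nat.mod_eq_of_lt (by omega)
    have m2 : f r % 2 ^ w = f r := Nat.mod_eq_of_lt (by omega)
    have m3 : (q + 1) % 2 ^ w = q + 1 := Nat.mod_eq_of_lt (by omega)
    have m4 : c₁.next r % 2 ^ w = c₁.next r := Nat.mod_eq_of_lt (by omega)
    have k1 : 2 + k ≠ 6 := by omega
    have k2 : 2 + k ≠ 8 := by omega
    have k3 : 6 ≠ 2 + k := by omega
    have k4 : 8 ≠ 2 + k := by omega
    have e17 := hreg 17 (by simp)
    have eQ : s'.mem 6 q q = r := hQs q (by omega)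
    simp only [wp_seq, wp_load, setReg_reg, setReg_mem, h18, eQ, e17, if_true, if_false,
      Nat.reduceEqDiff, eT, m1, m2, hs.mark _ hu, wp_ite, wp_skip, wp_op, wp_store, Op.eval,
      Test.Holds, e3, e2, setMem_reg, setMem_mem, e16, k1, k2, false_and, hs.next _ hr, m3, m4]
    constructor
    · intro hz
      have hnot : f r ∉ c₁.reached := fun h => by simp [h, Nat.mod_eq_of_lt hw] at hz
      rw [if_neg hnot] at hgrow
      have hcard' : (insert (f r) c₁.reached).card = c₁.reached.card + 1 :=
        Finset.card_insert_of_notMem hnot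
      have hsub : insert (f r) c₁.reached ⊆ Finset.range n :=
        Finset.insert_subset (by simpa using hu) hs.sub
      have hle := Finset.card_le_card hsub
      rw [Finset.card_range] at hle
      have hur : f r ≠ r := fun h => hnot (by rwa [h])
      refine ⟨13 * (hi - (q + 1)), by omega, q + 1, by omega, by omega, rfl, rfl, ?_, ?_⟩
      · rw [hgrow]
        refine ⟨?_, ?_, ?_, ?_, hsub, hs.cycle.insert hrc₁ hnot⟩
        · intro x hx
          simp [update_apply, k1, k2, hs.next x hx]
        · intro x hx
          simp [k4, hs.mark x hx]
          by_cases hxu : x = f r <;> simp [hxu]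
        · simp only [hcard', Finset.range_add_one, Finset.image_insert]
          have h1 := hs.queue
          congr 1
          · simp [k3]
          · rw [h1, Finset.card_image_of_injOn, Finset.card_range]
            · refine Finset.image_congr fun p hp => ?_
              have : p ≠ c₁.reached.card := by
                simp at hp; omega
              simp [k3, this]
            · intro a ha b hb hab
              exact hs.queue_inj (by simpa using ha) (by simpa using hb) hab
        · simp [hcard', Nat.mod_eq_of_lt (show c₁.reached.card + 1 < 2 ^ w by omega)]
      · intro p hp
        have : p ≠ c₁.reached.card := by
          have := Finset.card_le_card (show c.reached ⊆ c₁.reached from Finset.subset_union_left)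
          omega
        simp [k3, this, hQs p hp]
    · intro hz
      have hin : f r ∈ c₁.reached := by
        by_contra h
        simp [h] at hz
      rw [if_pos hin] at hgrow
      refine ⟨13 * (hi - (q + 1)), by omega, q + 1, by omega, by omega, rfl, rfl, ?_, hQs⟩
      rw [hgrow]
      exact ⟨hs.next, hs.mark, hs.queue, by simp [e16], hs.sub, hs.cycle⟩
  · rintro t s' ⟨hnlt, φ, ht, q, hloq, hqhi, h18, rfl, hs, hQs⟩ hfr
    have h15 : s'.reg 15 = hi := by
      rw [hfr.reg 15 (by simp [Prog.regs])]; simp [hhi]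
    simp only [Test.Holds, h18, h15, not_lt] at hnlt
    obtain rfl : q = hi := le_antisymm hqhi hnlt
    exact ⟨by omega, hs, hQs⟩
end WordRAM

/-! ### The initial cycle -/

theorem CycConfig.start_oneCycle {n v : ℕ} {f : Equiv.Perm ℕ} (hf : ∀ x, n ≤ x → f x = x)
    (hv : v < n) : OneCycle v (start n f v).reached (start n f v).next := by
  have hmem : ∀ x, x ∈ (start n f v).reached ↔ x < n ∧ f.SameCycle v x := by
    simp [start]
  have hnext : ∀ x ∈ (start n f v).reached, (start n f v).next x = f x := fun x hx => by
    rw [hmem] at hx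
    simp [start, hx]
  have hmaps : ∀ x ∈ (start n f v).reached, (start n f v).next x ∈ (start n f v).reached :=
    fun x hx => by
      rw [hnext x hx, hmem]
      rw [hmem] at hx
      exact ⟨f.apply_lt_of_fixes hf hx.1, Equiv.Perm.sameCycle_apply_right.2 hx.2⟩
  have hv' : v ∈ (start n f v).reached := (hmem v).2 ⟨hv, Equiv.Perm.SameCycle.refl _ _⟩
  have hit : ∀ k, (start n f v).next^[k] v = f^[k] v ∧ f^[k] v ∈ (start n f v).reached := by
    intro k
    induction k with
    | zero => exact ⟨rfl, hv'⟩
    | succ k ih =>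
      have h1 := hnext _ ih.2
      rw [iterate_succ_apply', iterate_succ_apply', ih.1, h1]
      exact ⟨rfl, h1 ▸ hmaps _ ih.2⟩
  refine ⟨hv', hmaps, fun x hx => ?_⟩
  have hper := f.mem_periodicPts_of_fixes hf v
  have hpos := minimalPeriod_pos_of_mem_periodicPts hper
  obtain ⟨k, -, rfl⟩ := (Equiv.Perm.sameCycle_iff_exists_iterate hper).1 ((hmem x).1 hx).2
  refine ⟨k + (minimalPeriod f v - 1), ?_⟩
  rw [(hit _).1, add_assoc, show minimalPeriod f v - 1 + 1 = minimalPeriod f v by omega,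
    iterate_add_apply, iterate_minimalPeriod]

theorem CycConfig.start_next (n v : ℕ) (f : Equiv.Perm ℕ) (x : ℕ) :
    (start n f v).next x = if x ∈ (start n f v).reached then f x else x := by
  classical
  simp only [start]
  exact ite_congr (by simp) (fun _ => rfl) fun _ => rfl

theorem CycConfig.start_reached_eq {n v : ℕ} {f : Equiv.Perm ℕ} (hf : ∀ x, n ≤ x → f x = x)
    (hv : v < n) :
    (start n f v).reached = (Finset.range (minimalPeriod f v)).image fun k => f^[k] v := by
  have hper := f.mem_periodicPts_of_fixes hf v
  have hlt : ∀ k, f^[k] v < n := fun k => by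
    induction k with
    | zero => exact hv
    | succ k ih => rw [iterate_succ_apply']; exact f.apply_lt_of_fixes hf ih
  ext x
  simp only [start, Finset.mem_filter, Finset.mem_range, Finset.mem_image,
    Equiv.Perm.sameCycle_iff_exists_iterate hper]
  refine ⟨fun h => h.2, fun h => ⟨?_, h⟩⟩
  obtain ⟨k, -, rfl⟩ := h
  exact hlt k

theorem CycConfig.start_card {n v : ℕ} {f : Equiv.Perm ℕ} (hf : ∀ x, n ≤ x → f x = x)
    (hv : v < n) : (start n f v).reached.card = minimalPeriod f v := by
  rw [start_reached_eq hf hv, Finset.card_image_of_injOn, Finset.card_range]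
  intro i hi j hj hij
  exact (iterate_eq_iterate_iff_of_lt_minimalPeriod (by simpa using hi) (by simpa using hj)).1 hij

namespace WordRAM

/-- Store the cycle of the point `reg rt` under the permutation in row `reg 5` of segment `k`, of
length `reg 4`, as a cyclic order. -/
def startCycle (k rt : ℕ) : Prog :=
  .seq (forLoop 13 0 (.seq (.store (2 + k) 13 13 13) (.store 8 13 13 3)))
    (.seq (.copy 20 rt) (.seq
      (forLoop 13 4 (.seq (.store 6 13 13 20) (.seq (.store 8 20 20 2) (.seq (.load 21 k 5 20)
        (.seq (.store (2 + k) 20 20 21) (.copy 20 21))))))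
      (.copy 16 4)))

/-- The first loop erases marks and successors left by an earlier trial, because the construction is
repeated in the same segments. It also produces the value `x` that `CycConfig.start` gives to points
off the cycle. -/
theorem wp_startCycle {w n k v rt : ℕ} {f : Equiv.Perm ℕ} {s : State}
    (hn : n < 2 ^ w) (hk : k < 2) (hrt : rt ∉ [13, 16, 20, 21]) (hf : ∀ x, n ≤ x → f x = x)
    (hv : v < n) (h0 : s.reg 0 = n) (h2 : s.reg 2 = 1) (h3 : s.reg 3 = 0)
    (h4 : s.reg 4 = minimalPeriod f v) (hr : s.reg rt = v)
    (hT : ∀ x < n, s.mem k (s.reg 5) x = f x) :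
    WP w (startCycle k rt) (fun t s' => t ≤ 12 * n + 10 ∧
      HoldsCyc n k v (CycConfig.start n f v) s') s := by
  have hw : 1 < 2 ^ w := by omega
  simp only [List.mem_cons, List.not_mem_nil, not_or, or_false] at hrt
  have hper := f.mem_periodicPts_of_fixes hf v
  have hlt : ∀ k, f^[k] v < n := fun k => by
    induction k with
    | zero => exact hv
    | succ k ih => rw [iterate_succ_apply']; exact f.apply_lt_of_fixes hf ih
  have hwit : ∀ k, f^[k] v % 2 ^ w = f^[k] v := fun k =>
    Nat.mod_eq_of_lt ((hlt k).trans hn)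
  have hcard := CycConfig.start_card hf hv
  have hLn : minimalPeriod f v ≤ n := by
    rw [← hcard]
    simpa using Finset.card_le_card (show (CycConfig.start n f v).reached ⊆ Finset.range n by
      simp [CycConfig.start])
  have k1 : 2 + k ≠ 6 := by omega
  have k2 : 2 + k ≠ 8 := by omega
  have k3 : 6 ≠ 2 + k := by omega
  have k4 : 8 ≠ 2 + k := by omega
  have k5 : k ≠ 6 := by omega
  have k6 : k ≠ 8 := by omega
  have k7 : k ≠ 2 + k := by omega
  rw [startCycle, wp_seq]
  refine WP.mono (wp_forLoop_const (fun m s' => ∀ x < m, s'.mem (2 + k) x x = x ∧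
    s'.mem 8 x x = 0) 2 h2 (by omega) (by simp [Prog.regs]) (by simp) ?_) ?_
  · intro m s' hm h13 hI hfr
    have e3 : s'.reg 3 = 0 := by rw [hfr.reg 3 (by simp [forLoop, Prog.regs]), h3]
    simp only [wp_seq, wp_store, setMem_reg, setReg_mem, setMem_mem, h13, e3]
    refine ⟨by omega, fun x hx => ?_⟩
    by_cases hxm : x = m
    · simp [hxm, k2]
    · simp [hxm, hI x (by omega)]
  · rintro t₁ s₁ ⟨ht₁, hI₁⟩ hf₁
    have hreg₁ : ∀ x, x ≠ 13 → s₁.reg x = s.reg x := fun x hx =>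
      hf₁.reg x (by simp [forLoop, Prog.regs, hx])
    have hmem₁ : s₁.mem k = s.mem k := hf₁.mem k (by simp [forLoop, Prog.segs, k6])
    rw [h0] at hI₁ ht₁
    rw [wp_seq, wp_copy, wp_seq]
    refine WP.mono (wp_forLoop_const (fun m s' => s'.reg 20 = f^[m] v ∧
      (∀ p < m, s'.mem 6 p p = f^[p] v) ∧
      (∀ x < n, s'.mem (2 + k) x x =
        if x ∈ (Finset.range m).image (fun p => f^[p] v) then f x else x) ∧
      ∀ x < n, s'.mem 8 x x = if x ∈ (Finset.range m).image (fun p => f^[p] v) then 1 else 0)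
      5 ?_ ?_ (by simp [Prog.regs]) ?_ ?_) ?_
    · simp [hreg₁, h2]
    · simp [hreg₁, h4]; omega
    · refine ⟨?_, by simp, fun x hx => ?_, fun x hx => ?_⟩
      · have := hwit 0
        simp only [iterate_zero, id] at this
        simp [hreg₁, hrt, hr, this]
      · simp [hI₁ x hx]
      · simp [hI₁ x hx]
    · rintro m s' hm h13 ⟨h20, hQ, hN, hM⟩ hfr
      have hreg : ∀ x ∉ [13, 20, 21], s'.reg x = s.reg x := fun x hx => by
        simp only [List.mem_cons, List.not_mem_nil, not_or, or_false] at hx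
        rw [hfr.reg x (by simp [forLoop, Prog.regs, hx])]
        simp [hx, hreg₁]
      have hT' : s'.mem k = s.mem k := by
        rw [hfr.mem k (by simp [forLoop, Prog.segs, k5, k6])]; simp [hmem₁]
      have e2 : s'.reg 2 = 1 := by rw [hreg 2 (by simp), h2]
      have e5 := hreg 5 (by simp)
      have hfm : f (f^[m] v) = f^[m + 1] v := (iterate_succ_apply' _ _ _).symm
      simp only [wp_seq, wp_store, wp_load, wp_copy, setMem_reg, setReg_reg, setReg_mem,
        setMem_mem, h13, h20, e2, e5, k5, k6, false_and, if_false, if_true, Nat.reduceEqDiff, hT',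
        hT _ (hlt m), hfm, hwit, Finset.range_add_one, Finset.image_insert, Finset.mem_insert]
      refine ⟨by omega, trivial, fun p hp => ?_, fun x hx => ?_, fun x hx => ?_⟩
      · by_cases hpm : p = m
        · simp [hpm, k3]
        · simp [hpm, k3, hQ p (by omega)]
      · by_cases hxm : x = f^[m] v
        · simp [hxm, hfm]
        · simp [hxm, k1, k2, hN x hx]
      · by_cases hxm : x = f^[m] v
        · simp [hxm, k4]
        · simp [hxm, k4, hM x hx]
    · rintro t₂ s₂ ⟨ht₂, -, hQ, hN, hM⟩ hf₂
      have e4 : s₂.reg 4 = minimalPeriod f v := by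
        rw [hf₂.reg 4 (by simp [forLoop, Prog.regs])]
        simp [hreg₁, h4]
      have e4' : (s₁.setReg w 20 (s₁.reg rt)).reg 4 = minimalPeriod f v := by
        simp [hreg₁, h4]
      rw [e4'] at ht₂ hQ hN hM
      rw [wp_copy, e4]
      rw [← CycConfig.start_reached_eq hf hv] at hN hM
      refine ⟨by omega, ?_, hM, ?_, ?_, by simp [CycConfig.start],
        CycConfig.start_oneCycle hf hv⟩
      · intro x hx
        rw [setReg_mem, hN x hx, CycConfig.start_next]
      · rw [hcard, CycConfig.start_reached_eq hf hv]
        refine Finset.image_congr fun p hp => ?_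
        rw [setReg_mem, hQ p (by simpa using hp)]
      · simp [hcard, Nat.mod_eq_of_lt (show minimalPeriod f v < 2 ^ w by omega)]

end WordRAM

/-! ### The complete breadth-first search -/

theorem CycConfig.layer_reached_mono (A : ℕ → Equiv.Perm ℕ) (F : Finset ℕ) (c : CycConfig) :
    Monotone fun j => (c.layer A F j).reached :=
  monotone_nat_of_le_succ fun _ => Finset.subset_union_left

theorem CycConfig.apply_mem_layer {A : ℕ → Equiv.Perm ℕ} {F : Finset ℕ} (c : CycConfig) {j d x : ℕ}
    (hj : j < d) (hx : x ∈ F) : A j x ∈ (c.layer A F d).reached :=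
  c.layer_reached_mono A F (Nat.succ_le_of_lt hj)
    (Finset.mem_union_right _ (Finset.mem_image_of_mem _ hx))

/-- The permutations `A j` with `j < d` act transitively on `{0, …, n - 1}`. -/
def TransitiveBelow (n d : ℕ) (A : ℕ → Equiv.Perm ℕ) : Prop :=
  ∀ R ⊆ Finset.range n, R.Nonempty → (∀ j < d, ∀ x ∈ R, A j x ∈ R) → R = Finset.range n

namespace WordRAM

theorem HoldsCyc.congr {n k v : ℕ} {c : CycConfig} {s s' : State} (h : HoldsCyc n k v c s)
    (hm : s'.mem = s.mem) (hr : s'.reg 16 = s.reg 16) : HoldsCyc n k v c s' :=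
  ⟨by rw [hm]; exact h.next, by rw [hm]; exact h.mark, by rw [hm]; exact h.queue,
    by rw [hr]; exact h.len, h.sub, h.cycle⟩

theorem wp_layer {w n d k v lo hi : ℕ} {A : ℕ → Equiv.Perm ℕ} {c : CycConfig} {s : State}
    (hn : n < 2 ^ w) (hd : d < 2 ^ w) (hk : k < 2) (hA : ∀ j x, d ≤ j ∨ n ≤ x → A j x = x)
    (h1 : s.reg 1 = d) (h2 : s.reg 2 = 1) (h3 : s.reg 3 = 0)
    (hlo : s.reg 14 = lo) (hhi : s.reg 15 = hi) (hlh : lo ≤ hi)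
    (hT : Tabulated n d k A s) (hc : HoldsCyc n k v c s) (hic : hi ≤ c.reached.card) :
    WP w (forLoop 17 1 (growPass k)) (fun t s' => t ≤ d * (13 * (hi - lo) + 4) + 2 ∧
      HoldsCyc n k v (c.layer A ((Finset.Ico lo hi).image fun p => s.mem 6 p p) d) s' ∧
      ∀ p < c.reached.card, s'.mem 6 p p = s.mem 6 p p) s := by
  set F := (Finset.Ico lo hi).image fun p => s.mem 6 p p with hF
  rw [← h1] at hd
  refine WP.mono (wp_forLoop_const (fun m s' => HoldsCyc n k v (c.layer A F m) s' ∧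
    ∀ p < c.reached.card, s'.mem 6 p p = s.mem 6 p p) (13 * (hi - lo) + 2) h2 hd
    (by simp [growPass, Prog.regs]) ⟨hc.congr (by simp) (by simp), by simp⟩ ?_) ?_
  · rintro m s' hm h17 ⟨hs, hQ⟩ hfr
    have hreg : ∀ x ∉ [16, 17, 18, 19, 20, 21], s'.reg x = s.reg x := fun x hx =>
      hfr.reg x (by simp_all [forLoop, growPass, Prog.regs])
    have hT' : s'.mem k = s.mem k := hfr.mem k (by simp [forLoop, growPass, Prog.segs]; omega)
    have hle : c.reached.card ≤ (c.layer A F m).reached.card :=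
      Finset.card_le_card (c.layer_reached_mono A F m.zero_le)
    refine (wp_growPass (f := A m) (lo := lo) (hi := hi) hn hk (fun x hx => hA m x (.inr hx))
      (by rw [hreg 2 (by simp), h2]) (by rw [hreg 3 (by simp), h3])
      (by rw [hreg 14 (by simp), hlo]) (by rw [hreg 15 (by simp), hhi]) hlh
      (fun x hx => by rw [h17, hT', hT m (by omega) x hx]) hs (hic.trans hle)).mono ?_
    rintro t s'' ⟨ht, hs'', hQ'⟩ -
    have hF' : ((Finset.Ico lo hi).image fun p => s'.mem 6 p p) = F :=
      Finset.image_congr fun p hp => hQ p (by simp at hp; omega)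
    rw [hF'] at hs''
    exact ⟨ht, hs''.congr (by simp) (by simp), fun p hp => by
      rw [setReg_mem, hQ' p (hp.trans_le hle), hQ p hp]⟩
  · rintro t s' ⟨ht, hs, hQ⟩ -
    rw [h1] at ht hs
    exact ⟨ht, hs, hQ⟩

/-- Breadth-first search: repeat `growPass` for all permutations on the frontier. -/
def search (k : ℕ) : Prog :=
  .seq (.const 14 0) (.seq (.copy 15 16) (.loop (.lt 14 15)
    (.seq (forLoop 17 1 (growPass k)) (.seq (.copy 14 15) (.copy 15 16)))))

/-- Every point is in the frontier for one round only, which bounds the cost by `O(d)` per point.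
When the frontier is empty, the reached set is closed under all `A j`, hence everything by
transitivity. -/
theorem wp_search {w n d k v : ℕ} {A : ℕ → Equiv.Perm ℕ} {c : CycConfig} {s : State}
    (hn : n < 2 ^ w) (hd : d < 2 ^ w) (hk : k < 2) (hA : ∀ j x, d ≤ j ∨ n ≤ x → A j x = x)
    (htr : TransitiveBelow n d A) (h1 : s.reg 1 = d) (h2 : s.reg 2 = 1) (h3 : s.reg 3 = 0)
    (hT : Tabulated n d k A s) (hc : HoldsCyc n k v c s) :
    WP w (search k) (fun t s' => t ≤ n * (17 * d + 5) + 3 ∧ ∃ T, (c.bfs A d T).2 = ∅ ∧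
      (c.bfs A d T).1.reached = Finset.range n ∧ HoldsCyc n k v (c.bfs A d T).1 s') s := by
  have hcn := hc.card_le
  rw [search, wp_seq, wp_const, wp_seq, wp_copy]
  -- Queue entries below `lo` have been processed with all permutations; those from `lo` on are the
  -- frontier.
  refine WP.mono (wp_loop (fun φ s' => ∃ T lo, lo ≤ (c.bfs A d T).1.reached.card ∧
    s'.reg 14 = lo ∧ s'.reg 15 = (c.bfs A d T).1.reached.card ∧ φ = (n - lo) * (17 * d + 5) ∧
    HoldsCyc n k v (c.bfs A d T).1 s' ∧
    (c.bfs A d T).2 = (Finset.Ico lo (c.bfs A d T).1.reached.card).image (fun p => s'.mem 6 p p) ∧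
    ∀ p < lo, ∀ j < d, A j (s'.mem 6 p p) ∈ (c.bfs A d T).1.reached)
    (φ := n * (17 * d + 5)) ?_ ?_) ?_
  · refine ⟨0, 0, by omega, by simp, ?_, by simp, hc.congr (by simp) (by simp), ?_, by simp⟩
    · simp [CycConfig.bfs, hc.len, Nat.mod_eq_of_lt (show c.reached.card < 2 ^ w by omega)]
    · simpa [CycConfig.bfs] using hc.queue
  · rintro φ s' ⟨T, lo, hle, h14, h15, rfl, hs, hF, hcl⟩ hfr hlt
    set cT := (c.bfs A d T).1 with hcT
    have hreg : ∀ x ∉ [14, 15, 16, 17, 18, 19, 20, 21], s'.reg x = s.reg x := fun x hx => by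
      rw [hfr.reg x (by simp_all [forLoop, growPass, Prog.regs])]
      simp_all
    have hT' : s'.mem k = s.mem k := by
      rw [hfr.mem k (by simp [forLoop, growPass, Prog.segs]; omega)]; simp
    simp only [Test.Holds, h14, h15] at hlt
    have hcTn := hs.card_le
    rw [wp_seq]
    refine (wp_layer (lo := lo) (hi := cT.reached.card) hn hd hk hA
      (by rw [hreg 1 (by simp), h1]) (by rw [hreg 2 (by simp), h2]) (by rw [hreg 3 (by simp), h3])
      h14 h15 hle (fun j hj x hx => by rw [hT', hT j hj x hx]) hs le_rfl).mono ?_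
    rw [← hF]
    rintro t s₁ ⟨ht, hs₁, hQ⟩ hf₁
    have e15 : s₁.reg 15 = cT.reached.card := by
      rw [hf₁.reg 15 (by simp [forLoop, growPass, Prog.regs]), h15]
    simp only [wp_seq, wp_copy, setReg_reg, Nat.reduceEqDiff, if_false]
    have hbfs : (c.bfs A d (T + 1)).1 = cT.layer A (c.bfs A d T).2 d := rfl
    have hbfs2 : (c.bfs A d (T + 1)).2 =
      (cT.layer A (c.bfs A d T).2 d).reached \ cT.reached := rfl
    set c' := cT.layer A (c.bfs A d T).2 d with hc'
    have hsub : cT.reached ⊆ c'.reached := cT.layer_reached_mono A _ d.zero_le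
    have hle' := Finset.card_le_card hsub
    have hc'n := hs₁.card_le
    refine ⟨(n - cT.reached.card) * (17 * d + 5), ?_, T + 1, cT.reached.card, ?_, ?_, ?_, rfl, ?_,
      ?_, ?_⟩
    -- The frontier has `δ + 1 ≥ 1` points, so the overhead `4 * d + 5` of the round can be charged
    -- to them as well.
    · obtain ⟨δ, hδ⟩ := Nat.exists_eq_add_of_lt hlt
      rw [show cT.reached.card - lo = δ + 1 by omega] at ht
      rw [show n - lo = (n - cT.reached.card) + (δ + 1) by omega]
      nlinarith [Nat.zero_le (d * δ)]
    · rw [hbfs]; exact hle'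
    · simp [e15, Nat.mod_eq_of_lt (show cT.reached.card < 2 ^ w by omega)]
    · simp [hbfs, hs₁.len, Nat.mod_eq_of_lt (show c'.reached.card < 2 ^ w by omega)]
    · rw [hbfs]; exact hs₁.congr (by simp) (by simp)
    · rw [hbfs2, hbfs]
      simp only [setReg_mem]
      ext x
      have hx : x ∈ cT.reached ↔ ∃ p < cT.reached.card, s₁.mem 6 p p = x := by
        conv_lhs => rw [hs.queue]
        simp only [Finset.mem_image, Finset.mem_range]
        exact ⟨fun ⟨p, hp, h⟩ => ⟨p, hp, by rw [hQ p hp, h]⟩,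
          fun ⟨p, hp, h⟩ => ⟨p, hp, by rw [← hQ p hp, h]⟩⟩
      have hx' : x ∈ c'.reached ↔ ∃ p < c'.reached.card, s₁.mem 6 p p = x := by
        conv_lhs => rw [hs₁.queue]
        simp only [Finset.mem_image, Finset.mem_range]
      rw [Finset.mem_sdiff, hx, hx']
      simp only [Finset.mem_image, Finset.mem_Ico]
      constructor
      · rintro ⟨⟨p, hp, h⟩, hno⟩
        exact ⟨p, ⟨not_lt.1 fun hp' => hno ⟨p, hp', h⟩, hp⟩, h⟩
      · rintro ⟨p, ⟨hp, hp'⟩, h⟩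
        refine ⟨⟨p, hp', h⟩, ?_⟩
        rintro ⟨q, hq, h'⟩
        have := hs₁.queue_inj hp' (hq.trans_le hle') (h.trans h'.symm)
        omega
    · intro p hp j hj
      rw [hbfs]
      simp only [setReg_mem]
      rw [hQ p hp]
      by_cases hpl : p < lo
      · exact hsub (hcl p hpl j hj)
      · refine cT.apply_mem_layer hj ?_
        rw [hF]
        exact Finset.mem_image.2 ⟨p, by simp; omega, rfl⟩
  · rintro t s' ⟨hn', φ, ht, T, lo, hle, h14, h15, rfl, hs, hF, hcl⟩ -
    simp only [Test.Holds, h14, h15, not_lt] at hn'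
    refine ⟨by omega, T, ?_, ?_, hs⟩
    · rw [hF, Finset.Ico_eq_empty (by omega), Finset.image_empty]
    · refine htr _ hs.sub ⟨_, hs.cycle.mem⟩ fun j hj x hx => ?_
      rw [hs.queue] at hx
      obtain ⟨p, hp, rfl⟩ := Finset.mem_image.1 hx
      exact hcl p (by simp at hp; omega) j hj

end WordRAM

/-! ### Displacements along the cyclic order -/

namespace WordRAM

/-- Number the points of the cyclic order, beginning with the point `reg rt`. -/
def positions (k rt : ℕ) : Prog :=
  .seq (.copy 20 rt) (forLoop 13 0 (.seq (.store 7 20 20 13) (.load 20 (2 + k) 20 20)))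

theorem wp_positions {w n k v rt : ℕ} {σ : ℕ → ℕ} {s : State} (hn : n < 2 ^ w) (hk : k < 2)
    (h0 : s.reg 0 = n) (h2 : s.reg 2 = 1) (hr : s.reg rt = v)
    (hσ : OneCycle v (Finset.range n) σ) (hN : ∀ x < n, s.mem (2 + k) x x = σ x) :
    WP w (positions k rt) (fun t s' => t ≤ 4 * n + 3 ∧
      ∀ p < n, s'.mem 7 (σ^[p] v) (σ^[p] v) = p) s := by
  have hlt : ∀ m, σ^[m] v < n := fun m => by simpa using hσ.iterate_mem hσ.mem m
  have hwit : ∀ m, σ^[m] v % 2 ^ w = σ^[m] v := fun m => Nat.mod_eq_of_lt ((hlt m).trans hn)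
  have hv : v % 2 ^ w = v := hwit 0
  have k7 : 2 + k ≠ 7 := by omega
  rw [positions, wp_seq, wp_copy]
  refine WP.mono (wp_forLoop_const (fun m s' => s'.reg 20 = σ^[m] v ∧
    ∀ p < m, s'.mem 7 (σ^[p] v) (σ^[p] v) = p) 2 (by simp [h2]) (by simp [h0, hn])
    (by simp [Prog.regs]) ⟨by simp [hr, hv], by simp⟩ ?_) ?_
  · rintro m s' hm h13 ⟨h20, hP⟩ hfr
    simp only [setReg_reg, if_false, h0, OfNat.zero_ne_ofNat] at hm
    have hmem : s'.mem (2 + k) = s.mem (2 + k) := by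
      rw [hfr.mem _ (by simp [forLoop, Prog.segs]; omega)]; simp
    have hs : σ (σ^[m] v) = σ^[m + 1] v := (iterate_succ_apply' _ _ _).symm
    simp only [wp_seq, wp_store, wp_load, setMem_reg, setReg_reg, setReg_mem, setMem_mem, h13, h20,
      k7, false_and, if_false, if_true, hmem, hN _ (hlt m), hs, hwit, Nat.reduceEqDiff]
    refine ⟨le_rfl, trivial, fun p hp => ?_⟩
    by_cases hpm : p = m
    · simp [hpm]
    · have : σ^[p] v ≠ σ^[m] v := fun he =>
        hpm (hσ.iterate_inj hσ.mem (by simp; omega) (by simpa using hm) he)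
      simp [this, hP p (by omega)]
  · rintro t s' ⟨ht, -, hP⟩ -
    simp only [setReg_reg, if_false, h0, OfNat.zero_ne_ofNat] at ht hP
    exact ⟨by omega, hP⟩

/-- Compute the displacements of all permutations along the cyclic order. -/
def displacements (k : ℕ) : Prog :=
  forLoop 17 1 (forLoop 13 0 (.seq (.load 20 k 17 13) (.seq (.load 20 7 20 20)
    (.seq (.load 21 7 13 13) (.seq
      (.ite (.lt 20 21) (.seq (.op .sub 21 21 20) (.op .sub 20 0 21)) (.op .sub 20 20 21))
      (.store (4 + k) 13 17 20))))))

theorem wp_displacements {w n d k v : ℕ} {A : ℕ → Equiv.Perm ℕ} {σ : ℕ → ℕ} {s : State}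
    (hn : n < 2 ^ w) (hd : d < 2 ^ w) (hk : k < 2) (hA : ∀ j x, d ≤ j ∨ n ≤ x → A j x = x)
    (h0 : s.reg 0 = n) (h1 : s.reg 1 = d) (h2 : s.reg 2 = 1)
    (hT : Tabulated n d k A s) (hσ : OneCycle v (Finset.range n) σ)
    (hP : ∀ p < n, s.mem 7 (σ^[p] v) (σ^[p] v) = p) :
    WP w (displacements k) (fun t s' => t ≤ d * (9 * n + 4) + 2 ∧
      Displacement n d A v σ (s'.mem (4 + k))) s := by
  have hAlt : ∀ l, ∀ x < n, A l x < n := fun l x hx =>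
    (A l).apply_lt_of_fixes (fun y hy => hA l y (.inr hy)) hx
  set P : ℕ → ℕ := fun x => s.mem 7 x x with hPdef
  have hpos : ∀ x < n, P x < n ∧ σ^[P x] v = x := fun x hx => by
    obtain ⟨p, hp, rfl⟩ := hσ.exists_lt (by simpa using hx)
    rw [Finset.card_range] at hp
    simp only [hPdef, hP p hp]
    exact ⟨hp, trivial⟩
  -- The difference of positions modulo `n`, written so that no intermediate value exceeds `n`;
  -- adding `n` first could overflow a word.
  set D : ℕ → ℕ → ℕ := fun x l =>
    if P (A l x) < P x then n - (P x - P (A l x)) else P (A l x) - P x with hD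
  have hDlt : ∀ x < n, ∀ l, D x l < n := fun x hx l => by
    have := hpos x hx
    have := hpos _ (hAlt l x hx)
    simp only [hD]
    split_ifs <;> omega
  have k1 : k ≠ 7 := by omega
  have k2 : k ≠ 4 + k := by omega
  have k3 : 7 ≠ 4 + k := by omega
  refine WP.mono (wp_forLoop_const (fun m s' => ∀ l < m, ∀ x < n, s'.mem (4 + k) x l = D x l)
    (9 * n + 2) h2 (by omega) (by simp [forLoop, Prog.regs]) (by simp) ?_) ?_
  · rintro l s₁ hl h17 hI₁ hf₁
    have hreg₁ : ∀ x ∉ [13, 17, 20, 21], s₁.reg x = s.reg x := fun x hx =>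
      hf₁.reg x (by simp_all [forLoop, Prog.regs])
    have e2 : s₁.reg 2 = 1 := by rw [hreg₁ 2 (by simp), h2]
    have e0 : s₁.reg 0 = n := by rw [hreg₁ 0 (by simp), h0]
    refine WP.mono (wp_forLoop_const (fun m s' => (∀ l' < l, ∀ x < n, s'.mem (4 + k) x l' = D x l') ∧
      ∀ x < m, s'.mem (4 + k) x l = D x l) 7 e2 (by omega) (by simp [Prog.regs])
      ⟨by simpa using hI₁, by simp⟩ ?_) ?_
    · rintro x s₂ hx h13 ⟨hI₂, hJ₂⟩ hf₂
      rw [e0] at hx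
      have hreg₂ : ∀ x ∉ [13, 20, 21], s₂.reg x = s₁.reg x := fun x hx =>
        hf₂.reg x (by simp_all [forLoop, Prog.regs])
      have hmem : ∀ i, i ≠ 4 + k → s₂.mem i = s.mem i := fun i hi => by
        rw [hf₂.mem i (by simp [forLoop, Prog.segs, hi]),
          hf₁.mem i (by simp [forLoop, Prog.segs, hi])]
      have eT : s₂.mem k l x = A l x := by rw [hmem k k2, hT l (by omega) x hx]
      have e17 : s₂.reg 17 = l := by rw [hreg₂ 17 (by simp), h17]
      have e0' : s₂.reg 0 = n := by rw [hreg₂ 0 (by simp), e0]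
      have hu := hAlt l x hx
      obtain ⟨p1, -⟩ := hpos x hx
      obtain ⟨p2, -⟩ := hpos _ hu
      have m1 : A l x % 2 ^ w = A l x := Nat.mod_eq_of_lt (by omega)
      have m2 : P (A l x) % 2 ^ w = P (A l x) := Nat.mod_eq_of_lt (by omega)
      have m3 : P x % 2 ^ w = P x := Nat.mod_eq_of_lt (by omega)
      have m4 : (P x - P (A l x)) % 2 ^ w = P x - P (A l x) := Nat.mod_eq_of_lt (by omega)
      have m5 : (P (A l x) - P x) % 2 ^ w = P (A l x) - P x := Nat.mod_eq_of_lt (by omega)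
      have e7 : ∀ y, s₂.mem 7 y y = P y := fun y => by rw [hmem 7 k3]
      simp only [wp_seq, wp_store, wp_load, wp_ite, wp_op, setReg_reg, setReg_mem,
        setMem_mem, h13, e17, if_false, if_true, Nat.reduceEqDiff, eT, m1, m2, m3, m4, m5, e7,
        Test.Holds, Op.eval, e0', OfNat.zero_ne_ofNat]
      constructor <;> intro hcmp
      · have hDx : D x l = n - (P x - P (A l x)) := by simp [hD, hcmp]
        have m6 := Nat.mod_eq_of_lt ((hDlt x hx l).trans hn)
        rw [← hDx, m6]
        refine ⟨by omega, fun l' hl' y hy => ?_, fun y hy => ?_⟩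
        · simp [hl'.ne, hI₂ l' hl' y hy]
        · by_cases hyx : y = x
          · simp [hyx]
          · simp [hyx, hJ₂ y (by omega)]
      · have hDx : D x l = P (A l x) - P x := by simp [hD, hcmp]
        rw [← hDx]
        refine ⟨by omega, fun l' hl' y hy => ?_, fun y hy => ?_⟩
        · simp [hl'.ne, hI₂ l' hl' y hy]
        · by_cases hyx : y = x
          · simp [hyx]
          · simp [hyx, hJ₂ y (by omega)]
    · rintro t s₂ ⟨ht, hI, hJ⟩ -
      rw [e0] at ht hJ
      refine ⟨by omega, fun l' hl' x hx => ?_⟩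
      rw [setReg_mem]
      rcases Nat.lt_succ_iff_lt_or_eq.1 hl' with h | rfl
      · exact hI l' h x hx
      · exact hJ x hx
  · rintro t s' ⟨ht, hI⟩ -
    rw [h1] at ht hI
    refine ⟨ht, hσ, fun x hx l hl => ?_, fun x hx l hl => ?_⟩
    · rw [hI l hl x hx]; exact hDlt x hx l
    · rw [hI l hl x hx]
      obtain ⟨p1, q1⟩ := hpos x hx
      obtain ⟨p2, q2⟩ := hpos _ (hAlt l x hx)
      conv_lhs => rw [← q1, ← iterate_add_apply]
      simp only [q1, hD]
      have hc := hσ.iterate_card hσ.mem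
      rw [Finset.card_range] at hc
      split_ifs with h
      · rw [show n - (P x - P (A l x)) + P x = P (A l x) + n by omega, iterate_add_apply, hc, q2]
      · rw [show P (A l x) - P x + P x = P (A l x) by omega, q2]

/-- Compute a cyclic order of all points, and the displacements along it, from the cycle of the
point `reg rt` under the permutation in row `reg 5` of segment `k`. -/
def build (k rt : ℕ) : Prog :=
  .seq (startCycle k rt) (.seq (search k) (.seq (positions k rt) (displacements k)))

/-- The result is identified with the abstract search `CycConfig.bfs` rather than merely with some
cyclic order. This is what allows the orders built for two tuples to be compared through
`CycConfig.Conj.bfs_of_empty`. -/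
theorem wp_build {w n d k v rt : ℕ} {A : ℕ → Equiv.Perm ℕ} {f : Equiv.Perm ℕ} {s : State}
    (hn : n < 2 ^ w) (hd : d < 2 ^ w) (hd1 : 1 ≤ d) (hk : k < 2)
    (hrt : rt ∉ [13, 14, 15, 16, 17, 18, 19, 20, 21])
    (hA : ∀ j x, d ≤ j ∨ n ≤ x → A j x = x) (htr : TransitiveBelow n d A)
    (hv : v < n) (h0 : s.reg 0 = n) (h1 : s.reg 1 = d) (h2 : s.reg 2 = 1) (h3 : s.reg 3 = 0)
    (h5 : s.reg 5 < d) (hf : A (s.reg 5) = f) (h4 : s.reg 4 = minimalPeriod f v)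
    (hr : s.reg rt = v) (hT : Tabulated n d k A s) :
    WP w (build k rt) (fun t s' => t ≤ 100 * (d * n) ∧ ∃ T,
      (((CycConfig.start n f v).bfs A d T).2 = ∅) ∧
      (∀ x < n, s'.mem (2 + k) x x = ((CycConfig.start n f v).bfs A d T).1.next x) ∧
      Displacement n d A v ((CycConfig.start n f v).bfs A d T).1.next (s'.mem (4 + k))) s := by
  simp only [List.mem_cons, List.not_mem_nil, not_or, or_false] at hrt
  have hff : ∀ x, n ≤ x → f x = x := fun x hx => by rw [← hf]; exact hA _ x (.inr hx)
  have kk : ∀ i, 6 ≤ i → i ≠ 2 + k ∧ i ≠ 4 + k ∧ 2 + k ≠ i ∧ 4 + k ≠ i ∧ k ≠ i := fun i hi => by omega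
  have r1 : ∀ x ∉ [13, 16, 20, 21], x ∉ (startCycle k rt).regs := fun x hx => by
    simp_all [startCycle, forLoop, Prog.regs]
  have r2 : ∀ x ∉ [14, 15, 16, 17, 18, 19, 20, 21], x ∉ (search k).regs := fun x hx => by
    simp_all [search, growPass, forLoop, Prog.regs]
  have r3 : ∀ x ∉ [13, 20], x ∉ (positions k rt).regs := fun x hx => by
    simp_all [positions, forLoop, Prog.regs]
  have g1 : k ∉ (startCycle k rt).segs := by
    simp [startCycle, forLoop, Prog.segs, kk]
  have g2 : k ∉ (search k).segs := by simp [search, growPass, forLoop, Prog.segs, kk]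
  have g3 : ∀ i, i ≠ 7 → i ∉ (positions k rt).segs := fun i hi => by
    simp [positions, forLoop, Prog.segs, hi]
  have g4 : 2 + k ∉ (displacements k).segs := by simp [displacements, forLoop, Prog.segs]
  rw [build, wp_seq]
  refine (wp_startCycle (f := f) hn hk (by simp [hrt]) hff hv h0 h2 h3 h4 hr
    (fun x hx => by rw [hT _ h5 x hx, hf])).mono ?_
  rintro t₁ s₁ ⟨ht₁, hc₁⟩ hf₁
  have q1 : ∀ x ∉ [13, 16, 20, 21], s₁.reg x = s.reg x := fun x hx => hf₁.reg x (r1 x hx)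
  rw [wp_seq]
  refine (wp_search hn hd hk hA htr (by rw [q1 1 (by simp), h1]) (by rw [q1 2 (by simp), h2])
    (by rw [q1 3 (by simp), h3])
    (fun j hj x hx => by rw [hf₁.mem k g1, hT j hj x hx]) hc₁).mono ?_
  rintro t₂ s₂ ⟨ht₂, T, hTe, hTr, hc₂⟩ hf₂
  have q2 : ∀ x ∉ [14, 15, 16, 17, 18, 19, 20, 21], s₂.reg x = s₁.reg x :=
    fun x hx => hf₂.reg x (r2 x hx)
  have hcyc := hc₂.cycle
  rw [hTr] at hcyc
  rw [wp_seq]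
  refine (wp_positions hn hk (by rw [q2 0 (by simp), q1 0 (by simp), h0])
    (by rw [q2 2 (by simp), q1 2 (by simp), h2])
    (by rw [q2 rt (by simp [hrt]), q1 rt (by simp [hrt]), hr]) hcyc hc₂.next).mono ?_
  rintro t₃ s₃ ⟨ht₃, hP⟩ hf₃
  have q3 : ∀ x ∉ [13, 20], s₃.reg x = s₂.reg x := fun x hx => hf₃.reg x (r3 x hx)
  refine (wp_displacements hn hd hk hA
    (by rw [q3 0 (by simp), q2 0 (by simp), q1 0 (by simp), h0])
    (by rw [q3 1 (by simp), q2 1 (by simp), q1 1 (by simp), h1])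
    (by rw [q3 2 (by simp), q2 2 (by simp), q1 2 (by simp), h2])
    (fun j hj x hx => by
      rw [hf₃.mem k (g3 k (kk 7 (by omega)).2.2.2.2), hf₂.mem k g2, hf₁.mem k g1, hT j hj x hx])
    hcyc hP).mono ?_
  rintro t₄ s₄ ⟨ht₄, hD⟩ hf₄
  refine ⟨?_, T, hTe, fun x hx => ?_, hD⟩
  · have e1 : n ≤ d * n := Nat.le_mul_of_pos_left n hd1
    have e2 : d ≤ d * n := Nat.le_mul_of_pos_right d (by omega)
    nlinarith
  · rw [hf₄.mem _ g4, hf₃.mem _ (g3 _ (kk 7 (by omega)).2.2.1), hc₂.next x hx]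

end WordRAM

/-! ### Comparing cyclic words on the machine -/

namespace WordRAM

/-- Decide whether the words of displacements for the cyclic orders in the segments `2` and `3`,
with base points `reg 6` and `reg 9`, agree up to a cyclic shift, and set register `7` if so.
Current shifts are compared letter by letter; when a difference is found, all shifts of the larger
word up to this position are discarded. -/
def compare : Prog :=
  .seq (.copy 23 0) (.seq (.copy 24 0) (.seq (.const 25 0) (.seq (.const 26 0) (.seq (.copy 27 6)
    (.seq (.copy 29 6) (.seq (.copy 28 9) (.seq (.copy 30 9) (.seq (.const 31 0)
    (.loop (.eq 31 3)
      (.seq (.load 32 4 27 26) (.seq (.load 33 5 28 26)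
        (.ite (.eq 32 33)
          (.seq (.op .add 26 26 2)
            (.ite (.eq 26 1)
              (.seq (.const 26 0) (.seq (.op .add 25 25 2) (.seq (.load 27 2 27 27)
                (.seq (.load 28 3 28 28)
                  (.ite (.eq 25 0) (.seq (.const 7 1) (.const 31 1)) .skip)))))
              .skip))
          (.seq (.op .add 25 25 2) (.seq
            (.ite (.lt 32 33)
              (.seq (.op .sub 24 24 25) (.seq (.load 30 3 28 28)
                (.ite (.eq 24 3) (.const 31 1) .skip)))
              (.seq (.op .sub 23 23 25) (.seq (.load 29 2 27 27)
                (.ite (.eq 23 3) (.const 31 1) .skip))))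
            (.seq (.const 25 0) (.seq (.const 26 0) (.seq (.copy 27 29) (.copy 28 30))))))))))))))))))

/-- The state of `compare` before a comparison: letters `l` of the displacements at position `k`
of the shifts by `i` and `j` are next. -/
structure Comparing (n d v v' : ℕ) (σ σ' : ℕ → ℕ) (S S' : ℕ → ℕ → ℕ) (i j k l : ℕ) (s : State) :
    Prop where
  i_lt : i < n
  j_lt : j < n
  k_lt : k < n
  l_lt : l < d
  r23 : s.reg 23 = n - i
  r24 : s.reg 24 = n - j
  r25 : s.reg 25 = k
  r26 : s.reg 26 = l
  r27 : s.reg 27 = σ^[i + k] v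
  r28 : s.reg 28 = σ'^[j + k] v'
  r29 : s.reg 29 = σ^[i] v
  r30 : s.reg 30 = σ'^[j] v'
  beaten : ShiftsBeaten (dispWord d v σ S) (dispWord d v' σ' S') i
  beaten' : ShiftsBeaten (dispWord d v' σ' S') (dispWord d v σ S) j
  words : ∀ k' < k, dispWord d v σ S (i + k') = dispWord d v' σ' S' (j + k')
  letters : ∀ l' < l, S (σ^[i + k] v) l' = S' (σ'^[j + k] v') l'

/-- Each mismatch discards `k + 1` shifts of the larger word; if all `n` shifts of one word are
gone, `ShiftsBeaten.lt_of_shift_eq` excludes a match. Success is stated for `k < n` and failure for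
all `k`, as needed for constructing an isomorphism and for refuting one. -/
theorem wp_compare {w n d v v' : ℕ} {A B : ℕ → Equiv.Perm ℕ} {σ σ' : ℕ → ℕ} {S S' : ℕ → ℕ → ℕ}
    {s : State} (hn : n < 2 ^ w) (hd : d < 2 ^ w) (hd1 : 1 ≤ d)
    (h0 : s.reg 0 = n) (h1 : s.reg 1 = d) (h2 : s.reg 2 = 1) (h3 : s.reg 3 = 0)
    (h6 : s.reg 6 = v) (h9 : s.reg 9 = v')
    (hD : Displacement n d A v σ S) (hD' : Displacement n d B v' σ' S')
    (hN : ∀ x < n, s.mem 2 x x = σ x) (hN' : ∀ x < n, s.mem 3 x x = σ' x)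
    (hS : s.mem 4 = S) (hS' : s.mem 5 = S') :
    WP w compare (fun t s' => t ≤ 100 * (d * n) ∧
      ((s'.reg 7 = 1 ∧ ∃ i j, ∀ k < n,
          dispWord d v σ S (i + k) = dispWord d v' σ' S' (j + k)) ∨
        (s'.reg 7 = s.reg 7 ∧ ¬ ∃ i j, ∀ k,
          dispWord d v σ S (i + k) = dispWord d v' σ' S' (j + k)))) s := by
  have hv := hD.root_lt
  have hv' := hD'.root_lt
  have hw : 1 < 2 ^ w := by omega
  have m1 : (1 : ℕ) % 2 ^ w = 1 := Nat.mod_eq_of_lt hw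
  have mn : n % 2 ^ w = n := Nat.mod_eq_of_lt hn
  have mv : v % 2 ^ w = v := Nat.mod_eq_of_lt (by omega)
  have mv' : v' % 2 ^ w = v' := Nat.mod_eq_of_lt (by omega)
  have dn : 1 ≤ d * n := Nat.mul_pos hd1 (by omega)
  simp only [compare, wp_seq, wp_copy, wp_const]
  -- Equal entries use up `k * d + l`. At a mismatch this is reset to `0`, and discarding `k + 1`
  -- shifts lowers the potential by `(k + 1) * d > k * d + l`. The extra `d * n` covers the
  -- comparison in progress.
  refine WP.mono (wp_loop (fun φ s' => (s'.reg 31 = 0 ∧ s'.reg 7 = s.reg 7 ∧ ∃ i j k l,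
      φ + 20 * (k * d + l) = 20 * (d * ((n - i) + (n - j)) + d * n) ∧
      Comparing n d v v' σ σ' S S' i j k l s') ∨
    (s'.reg 31 = 1 ∧ ((s'.reg 7 = 1 ∧ ∃ i j, ∀ k < n,
          dispWord d v σ S (i + k) = dispWord d v' σ' S' (j + k)) ∨
        (s'.reg 7 = s.reg 7 ∧ ¬ ∃ i j, ∀ k,
          dispWord d v σ S (i + k) = dispWord d v' σ' S' (j + k)))))
    (φ := 20 * (d * (n + n) + d * n)) ?_ ?_) ?_
  · refine .inl ⟨by simp, by simp, 0, 0, 0, 0, by simp, by omega, by omega, by omega, hd1,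
      ?_, ?_, ?_, ?_, ?_, ?_, ?_, ?_, .zero _ _, .zero _ _, by simp, by simp⟩ <;>
      simp [h0, h6, h9, mn, mv, mv']
  · rintro φ s' (⟨h31, h7, i, j, k, l, hφ, hc⟩ | ⟨h31, -⟩) hf ht
    swap
    · have : s'.reg 3 = 0 := by rw [hf.reg 3 (by simp [Prog.regs])]; simp [h3]
      simp [Test.Holds, h31, this] at ht
    have hreg : ∀ x < 4, s'.reg x = s.reg x := fun x hx => by
      rw [hf.reg x (by simp [Prog.regs]; omega)]
      have : ∀ y, 23 ≤ y → x ≠ y := fun y hy => by omega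
      simp [this]
    have hmem : s'.mem = s.mem := by
      ext1 x
      rw [hf.mem x (by simp [Prog.segs])]; simp
    obtain ⟨hi, hj, hk, hl, e23, e24, e25, e26, e27, e28, e29, e30, hb, hb', hwd, hlt⟩ := hc
    have e0 : s'.reg 0 = n := by rw [hreg 0 (by omega), h0]
    have e1 : s'.reg 1 = d := by rw [hreg 1 (by omega), h1]
    have e2 : s'.reg 2 = 1 := by rw [hreg 2 (by omega), h2]
    have e3 : s'.reg 3 = 0 := by rw [hreg 3 (by omega), h3]
    set x := σ^[i + k] v with hx
    set y := σ'^[j + k] v' with hy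
    have hxn : x < n := hD.iterate_lt hv _
    have hyn : y < n := hD'.iterate_lt hv' _
    have hsx : σ x = σ^[i + (k + 1)] v := (iterate_succ_apply' _ _ _).symm
    have hsy : σ' y = σ'^[j + (k + 1)] v' := (iterate_succ_apply' _ _ _).symm
    have a1 := hD.lt x hxn l hl
    have a2 := hD'.lt y hyn l hl
    have a3 := hD.iterate_lt hv (i + (k + 1))
    have a4 := hD'.iterate_lt hv' (j + (k + 1))
    have a5 := hD.iterate_lt hv i
    have a6 := hD'.iterate_lt hv' j
    have b1 : S x l % 2 ^ w = S x l := Nat.mod_eq_of_lt (by omega)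
    have b2 : S' y l % 2 ^ w = S' y l := Nat.mod_eq_of_lt (by omega)
    have b3 : (l + 1) % 2 ^ w = l + 1 := Nat.mod_eq_of_lt (by omega)
    have b4 : (k + 1) % 2 ^ w = k + 1 := Nat.mod_eq_of_lt (by omega)
    have b5 : σ^[i + (k + 1)] v % 2 ^ w = σ^[i + (k + 1)] v := Nat.mod_eq_of_lt (by omega)
    have b6 : σ'^[j + (k + 1)] v' % 2 ^ w = σ'^[j + (k + 1)] v' := Nat.mod_eq_of_lt (by omega)
    have b7 : (n - i - (k + 1)) % 2 ^ w = n - i - (k + 1) := Nat.mod_eq_of_lt (by omega)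
    have b8 : (n - j - (k + 1)) % 2 ^ w = n - j - (k + 1) := Nat.mod_eq_of_lt (by omega)
    have b9 : σ^[i] v % 2 ^ w = σ^[i] v := Nat.mod_eq_of_lt (by omega)
    have b10 : σ'^[j] v' % 2 ^ w = σ'^[j] v' := Nat.mod_eq_of_lt (by omega)
    have hkd : (k + 1) * d ≤ d * n := by rw [mul_comm d]; exact Nat.mul_le_mul_right d hk
    rw [Nat.succ_mul] at hkd
    have hφ20 : 20 ≤ φ := by
      have : 0 ≤ d * (n - i + (n - j)) := Nat.zero_le _
      omega
    simp only [wp_seq, wp_load, wp_ite, wp_op, wp_const, wp_copy, wp_skip, setReg_reg, setReg_mem,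
      hmem, hS, hS', Test.Holds, Op.eval, e23, e24, e25, e26, e27, e28, e29, e30, e0, e1, e2, e3,
      hN x hxn, hN' y hyn, hsx, hsy, b1, b2, b3, b4, b5, b6, b7, b8, Nat.reduceEqDiff,
      if_true, if_false, OfNat.zero_ne_ofNat,
      OfNat.one_ne_ofNat, h31, h7, m1, Nat.zero_mod]
    have eqW (h : S x l = S' y l) (hld : l + 1 = d) : ∀ k' < k + 1,
        dispWord d v σ S (i + k') = dispWord d v' σ' S' (j + k') := fun k' hk' => by
      rcases Nat.lt_succ_iff_lt_or_eq.1 hk' with hk' | rfl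
      · exact hwd k' hk'
      · refine dispWord_eq fun l' hl' => ?_
        rcases Nat.lt_succ_iff_lt_or_eq.1 (hld.symm ▸ hl' : l' < l + 1) with hl' | rfl
        exacts [hlt l' hl', h]
    have per := hD.dispWord_add
    have per' := hD'.dispWord_add
    refine ⟨fun heq => ⟨fun hld => ⟨fun hkn => ?_, fun hkn => ?_⟩, fun hld => ?_⟩,
      fun hne => ⟨fun hlt' => ⟨fun h0 => ?_, fun h0 => ?_⟩, fun hge => ⟨fun h0 => ?_, fun h0 => ?_⟩⟩⟩
    · exact ⟨0, by omega, .inr ⟨trivial, .inl ⟨trivial, i, j, hkn ▸ eqW heq hld⟩⟩⟩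
    · refine ⟨φ - 20, by omega, .inl ⟨trivial, trivial, i, j, k + 1, 0, ?_, hi, hj, by omega,
        hd1, ?_, ?_, ?_, ?_, ?_, ?_, ?_, ?_, hb, hb', eqW heq hld, by simp⟩⟩
      · rw [add_mul k 1 d, one_mul]; omega
      all_goals simp [*]
    · refine ⟨φ - 20, by omega, .inl ⟨trivial, trivial, i, j, k, l + 1, by omega, hi, hj, hk,
        by omega, ?_, ?_, ?_, ?_, ?_, ?_, ?_, ?_, hb, hb', hwd, fun l' hl' => ?_⟩⟩
      on_goal 9 =>
        rcases Nat.lt_succ_iff_lt_or_eq.1 hl' with hl' | rfl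
        exacts [hlt l' hl', heq]
      all_goals simp [*]
    -- In the first two of the four mismatch cases the second word is larger and loses the shifts
    -- `j, …, j + k`; in the other two the first word loses `i, …, i + k`.
    all_goals
      first
      | have hbj := hb'.add (fun k' hk' => (hwd k' hk').symm) (dispWord_lt hl hlt hlt')
        clear hb'
      | have hbi := hb.add hwd (dispWord_lt hl (fun l' hl' => (hlt l' hl').symm)
          (show S' y l < S x l by omega))
        clear hb
    · refine ⟨0, by omega, .inr ⟨trivial, .inr ⟨trivial, fun ⟨i₀, j₀, h⟩ => ?_⟩⟩⟩
      have := hbj.lt_of_shift_eq (by omega) per' per fun k => (h k).symm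
      omega
    · refine ⟨20 * (d * (n - i + (n - (j + (k + 1)))) + d * n), ?_, .inl ⟨trivial, trivial, i,
        j + (k + 1), 0, 0, by simp, hi, by omega, by omega, hd1, ?_, ?_, ?_, ?_, ?_, ?_, ?_, ?_,
        hb, hbj, by simp, by simp⟩⟩
      · have : d * (n - i + (n - j)) = d * (n - i + (n - (j + (k + 1)))) + (k * d + d) := by
          rw [show n - j = n - (j + (k + 1)) + (k + 1) by omega]; ring
        omega
      all_goals simp [*, Nat.sub_sub]
      exact Nat.mod_eq_of_lt (by omega)
    · refine ⟨0, by omega, .inr ⟨trivial, .inr ⟨trivial, fun ⟨i₀, j₀, h⟩ => ?_⟩⟩⟩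
      have := hbi.lt_of_shift_eq (by omega) per per' h
      omega
    · refine ⟨20 * (d * (n - (i + (k + 1)) + (n - j)) + d * n), ?_, .inl ⟨trivial, trivial,
        i + (k + 1), j, 0, 0, by simp, by omega, hj, by omega, hd1, ?_, ?_, ?_, ?_, ?_, ?_, ?_, ?_,
        hbi, hb', by simp, by simp⟩⟩
      · have : d * (n - i + (n - j)) = d * (n - (i + (k + 1)) + (n - j)) + (k * d + d) := by
          rw [show n - i = n - (i + (k + 1)) + (k + 1) by omega]; ring
        omega
      all_goals simp [*, Nat.sub_sub]
      exact Nat.mod_eq_of_lt (by omega)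
  · rintro t s' ⟨hne, φ, ht, h⟩ hf
    have : s'.reg 3 = 0 := by rw [hf.reg 3 (by simp [Prog.regs])]; simp [h3]
    rcases h with ⟨h31, -⟩ | ⟨-, h⟩
    · simp [Test.Holds, h31, this] at hne
    · refine ⟨?_, h⟩
      have : d * (n + n) = 2 * (d * n) := by ring
      omega

end WordRAM

/-! ### Cycle lengths under conjugation -/

theorem Equiv.Perm.SameCycle.minimalPeriod_eq {f : Equiv.Perm ℕ} {x y : ℕ}
    (hx : x ∈ periodicPts f) (h : f.SameCycle x y) : minimalPeriod f y = minimalPeriod f x := by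
  obtain ⟨k, -, rfl⟩ := (Equiv.Perm.sameCycle_iff_exists_iterate hx).1 h
  exact minimalPeriod_apply_iterate hx k

theorem Equiv.Perm.minimalPeriod_of_conj {f g τ : Equiv.Perm ℕ} (h : ∀ x, f (τ x) = τ (g x))
    (x : ℕ) : minimalPeriod f (τ x) = minimalPeriod g x := by
  rw [minimalPeriod_eq_minimalPeriod_iff]
  have hit : ∀ k, f^[k] (τ x) = τ (g^[k] x) := fun k => by
    induction k with
    | zero => rfl
    | succ k ih => rw [iterate_succ_apply', ih, h, iterate_succ_apply']
  intro k
  rw [IsPeriodicPt, IsFixedPt, IsPeriodicPt, IsFixedPt, hit, τ.injective.eq_iff]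

theorem Equiv.Perm.sameCycle_of_conj {f g τ : Equiv.Perm ℕ} (h : ∀ x, f (τ x) = τ (g x))
    {x y : ℕ} (hxy : g.SameCycle x y) : f.SameCycle (τ x) (τ y) := by
  have hf : f = τ * g * τ⁻¹ := by
    ext x
    simpa using h (τ⁻¹ x)
  rw [hf, Equiv.Perm.sameCycle_conj]
  simpa using hxy

/-! ### Finding a longest cycle -/

namespace WordRAM

/-- Find a longest cycle of the permutations in segment `0`: its length, the index of the
permutation and a point of the cycle are put into the registers `4`, `5` and `6`. -/
def longestCycle : Prog :=
  forLoop 8 1 (forLoop 9 0 (.seq (walk 0 9 8 9)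
    (.ite (.lt 4 11) (.seq (.copy 4 11) (.seq (.copy 5 8) (.copy 6 9))) .skip)))

/-- The registers `4`, `5` and `6` describe a cycle, if one has been found. -/
def FoundCycle (n d : ℕ) (A : ℕ → Equiv.Perm ℕ) (s : State) : Prop :=
  s.reg 4 = 0 ∨ s.reg 5 < d ∧ s.reg 6 < n ∧ s.reg 4 = minimalPeriod (A (s.reg 5)) (s.reg 6)

/-- For each permutation the potential `5 * (n - V.card)` pays for the walks, as each point is
marked once. A walk from an unmarked point returns the length of its cycle, and all points of that
cycle share it. -/
theorem wp_longestCycle {w n d : ℕ} {A : ℕ → Equiv.Perm ℕ} {s : State}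
    (hn : n < 2 ^ w) (hd : d < 2 ^ w) (hn1 : 1 ≤ n) (hd1 : 1 ≤ d)
    (hA : ∀ j x, d ≤ j ∨ n ≤ x → A j x = x)
    (h0 : s.reg 0 = n) (h1 : s.reg 1 = d) (h2 : s.reg 2 = 1) (h3 : s.reg 3 = 0)
    (h4 : s.reg 4 = 0) (hT : Tabulated n d 0 A s) (hM : ∀ j x, s.mem 9 j x = 0) :
    WP w longestCycle (fun t s' => t ≤ d * (16 * n + 4) + 2 ∧
      s'.reg 5 < d ∧ s'.reg 6 < n ∧ s'.reg 4 = minimalPeriod (A (s'.reg 5)) (s'.reg 6) ∧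
      ∀ j < d, ∀ x < n, minimalPeriod (A j) x ≤ s'.reg 4) s := by
  refine WP.mono (wp_forLoop_const (fun m s' => FoundCycle n d A s' ∧
    (∀ j < m, ∀ x < n, minimalPeriod (A j) x ≤ s'.reg 4) ∧
    ∀ j, m ≤ j → ∀ x, s'.mem 9 j x = 0) (16 * n + 2) h2 (by omega)
    (by simp [forLoop, walk, Prog.regs]) ⟨.inl (by simp [h4]), by simp, by simpa using hM⟩ ?_) ?_
  · rintro j s₁ hj h8 ⟨hF₁, hmax₁, hM₁⟩ hf₁
    rw [h1] at hj
    have hreg₁ : ∀ x < 4, s₁.reg x = s.reg x := fun x hx =>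
      hf₁.reg x (by simp [forLoop, walk, Prog.regs]; omega)
    have e0 : s₁.reg 0 = n := by rw [hreg₁ 0 (by omega), h0]
    have e1 : s₁.reg 1 = d := by rw [hreg₁ 1 (by omega), h1]
    have e2 : s₁.reg 2 = 1 := by rw [hreg₁ 2 (by omega), h2]
    have e3 : s₁.reg 3 = 0 := by rw [hreg₁ 3 (by omega), h3]
    have hmem₁ : s₁.mem 0 = s.mem 0 := hf₁.mem 0 (by simp [forLoop, walk, Prog.segs])
    have hAj : ∀ x, n ≤ x → A j x = x := fun x hx => hA j x (.inr hx)
    refine WP.mono (wp_forLoop (fun m φ s' => (FoundCycle n d A s' ∧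
      (∀ j' < j, ∀ x < n, minimalPeriod (A j') x ≤ s'.reg 4) ∧
      ∀ j', j + 1 ≤ j' → ∀ x, s'.mem 9 j' x = 0) ∧
      ∃ V ⊆ Finset.range n, (∀ x, A j x ∈ V ↔ x ∈ V) ∧ Marks n 9 j V s' ∧
        φ = 5 * (n - V.card) ∧ (∀ x < m, x ∈ V) ∧
        ∀ x ∈ V, minimalPeriod (A j) x ≤ s'.reg 4) (φ := 5 * n) (c := 9) e2 (by omega)
      (by simp [walk, Prog.regs]) ?_ ?_) ?_
    · refine ⟨⟨by simpa [FoundCycle] using hF₁, by simpa using hmax₁,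
        fun j' hj' x => by simpa using hM₁ j' (by omega) x⟩, ∅, by simp, by simp,
        fun x _ => by simpa using hM₁ j le_rfl x, by simp, by simp, by simp⟩
    · rintro i φ s₂ hi h9 ⟨⟨hF₂, hmax₂, hM₂⟩, V, hVn, hVc, hVm, rfl, hVi, hVmax⟩ hf₂
      rw [e0] at hi
      have hreg₂ : ∀ x ∈ [0, 1, 2, 3, 8], s₂.reg x = s₁.reg x := fun x hx =>
        hf₂.reg x (by simp at hx; simp [forLoop, walk, Prog.regs]; omega)
      have hmem₂ : s₂.mem 0 = s.mem 0 := by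
        rw [hf₂.mem 0 (by simp [forLoop, walk, Prog.segs]), hmem₁]
      have e8 : s₂.reg 8 = j := by rw [hreg₂ 8 (by simp), h8]
      rw [wp_seq]
      refine (wp_walk (f := A j) (iv := i) (jv := j) (V := V) hn hAj hVn hVc (by simp) (by simp)
        (by rw [hreg₂ 2 (by simp), e2]) (by rw [hreg₂ 3 (by simp), e3]) e8 h9 hi
        (fun x hx => by rw [hmem₂, hT j hj x hx]) hVm).mono ?_
      rintro t s₃ ⟨ht, hrow, V', hVn', hVc', hVm', hcard, hV', hlen⟩ hf₃
      have hreg₃ : ∀ x ∈ [4, 5, 6, 8, 9], s₃.reg x = s₂.reg x := fun x hx =>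
        hf₃.reg x (by simp at hx; simp [walk, Prog.regs]; omega)
      have f4 := hreg₃ 4 (by simp)
      have f5 := hreg₃ 5 (by simp)
      have f6 := hreg₃ 6 (by simp)
      have f8 := hreg₃ 8 (by simp)
      have f9 := hreg₃ 9 (by simp)
      have hle := Finset.card_le_card hVn'
      rw [Finset.card_range] at hle
      have m11 : s₃.reg 11 % 2 ^ w = s₃.reg 11 := Nat.mod_eq_of_lt (by omega)
      have mj : j % 2 ^ w = j := Nat.mod_eq_of_lt (by omega)
      have mi : i % 2 ^ w = i := Nat.mod_eq_of_lt (by omega)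
      have hVi' : ∀ x < i + 1, x ∈ V' := fun x hx => by
        rw [hV']
        rcases Nat.lt_succ_iff_lt_or_eq.1 hx with h | rfl
        · exact .inl (hVi x h)
        · exact .inr (Equiv.Perm.SameCycle.refl _ _)
      have hnew : ∀ x ∈ V', x ∉ V → minimalPeriod (A j) x = s₃.reg 11 := fun x hx hxV => by
        have hper := (A j).mem_periodicPts_of_fixes hAj i
        have hsc := ((hV' x).1 hx).resolve_left hxV
        rw [hsc.minimalPeriod_eq hper, hlen, if_neg]
        intro hiV
        rw [if_pos hiV] at hlen
        have hsub : V ⊆ V' := fun y hy => (hV' y).2 (.inl hy)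
        exact hxV (Finset.eq_of_subset_of_card_le hsub (by omega) ▸ hx)
      have hrow' : ∀ j', j + 1 ≤ j' → ∀ x, s₃.mem 9 j' x = 0 := fun j' hj' x => by
        rw [hrow j' (by omega)]; exact hM₂ j' hj' x
      simp only [wp_ite, wp_seq, wp_copy, wp_skip, setReg_reg, Test.Holds, f4, f8, f9, h9, e8,
        Nat.reduceEqDiff, if_true, if_false, m11, setReg_mem]
      constructor <;> intro hcmp
      · refine ⟨5 * (n - V'.card), by omega, ⟨.inr ?_, ?_, ?_⟩, V', hVn', hVc', ?_, rfl, hVi', ?_⟩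
        · simp only [setReg_reg, Nat.reduceEqDiff, if_true, if_false, mj, mi]
          refine ⟨hj, hi, ?_⟩
          rw [m11, hlen, if_neg]
          intro hiV
          rw [if_pos hiV] at hlen
          omega
        · intro j' hj' x hx
          simpa using (hmax₂ j' hj' x hx).trans hcmp.le
        · simpa using hrow'
        · intro x hx; simpa using hVm' x hx
        · intro x hx
          by_cases hxV : x ∈ V
          · exact (hVmax x hxV).trans hcmp.le
          · exact (hnew x hx hxV).le
      · refine ⟨5 * (n - V'.card), by omega, ⟨?_, ?_, ?_⟩, V', hVn', hVc', ?_, rfl, hVi', ?_⟩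
        · simpa [FoundCycle, f4, f5, f6] using hF₂
        · intro j' hj' x hx
          simpa [f4] using hmax₂ j' hj' x hx
        · simpa using hrow'
        · intro x hx; simpa using hVm' x hx
        · intro x hx
          by_cases hxV : x ∈ V
          · exact hVmax x hxV
          · exact (hnew x hx hxV).le.trans (by omega)
    · rintro t s₂ ⟨φ, ht, ⟨hF₂, hmax₂, hM₂⟩, V, hVn, hVc, hVm, rfl, hVi, hVmax⟩ -
      rw [e0] at ht hVi
      refine ⟨by omega, by simpa [FoundCycle] using hF₂, fun j' hj' x hx => ?_, fun j' hj' x => ?_⟩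
      · simp only [setReg_reg, Nat.reduceEqDiff, if_false]
        rcases Nat.lt_succ_iff_lt_or_eq.1 hj' with h | rfl
        · exact hmax₂ j' h x hx
        · exact hVmax x (hVi x hx)
      · simpa using hM₂ j' hj' x
  · rintro t s' ⟨ht, hF, hmax, -⟩ -
    rw [h1] at ht hmax
    have h1 := hmax 0 hd1 0 hn1
    have h2 := minimalPeriod_pos_of_mem_periodicPts
      ((A 0).mem_periodicPts_of_fixes (fun x hx => hA 0 x (.inr hx)) 0)
    obtain h | ⟨h5, h6, h⟩ := hF
    · omega
    · exact ⟨ht, h5, h6, h, hmax⟩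

end WordRAM

/-! ### Trying all cycles of the right length -/

namespace WordRAM

/-- For the first point of every cycle of the permutation in row `reg 5` of segment `1` whose
length is `reg 4`, compare the cyclic order grown from this cycle with the one in segment `2`. -/
def matchCycles : Prog :=
  forLoop 9 0 (.seq (walk 1 10 5 9) (.ite (.eq 11 4) (.seq (build 1 9) compare) .skip))

/-- A trial costs at most `200 * (d * n)` and happens only after `L` new points have been marked. As
`n ≤ M * L`, a potential of `200 * (d * M)` per unmarked point pays for it. -/
theorem wp_matchCycles {w n d M v T : ℕ} {A B : ℕ → Equiv.Perm ℕ} {f : Equiv.Perm ℕ} {s : State}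
    (hn : n < 2 ^ w) (hd : d < 2 ^ w) (hd1 : 1 ≤ d)
    (hA : ∀ j x, d ≤ j ∨ n ≤ x → A j x = x) (hB : ∀ j x, d ≤ j ∨ n ≤ x → B j x = x)
    (htr : TransitiveBelow n d B)
    (h0 : s.reg 0 = n) (h1 : s.reg 1 = d) (h2 : s.reg 2 = 1) (h3 : s.reg 3 = 0)
    (h4 : s.reg 4 = minimalPeriod f v) (h5 : s.reg 5 < d) (hf : A (s.reg 5) = f)
    (h6 : s.reg 6 = v) (hv : v < n) (h7 : s.reg 7 = 0) (hM : n ≤ M * minimalPeriod f v)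
    (hT : Tabulated n d 1 B s) (hV : ∀ j x, s.mem 10 j x = 0)
    (hTe : ((CycConfig.start n f v).bfs A d T).2 = ∅)
    (hN : ∀ x < n, s.mem 2 x x = ((CycConfig.start n f v).bfs A d T).1.next x)
    (hD : Displacement n d A v ((CycConfig.start n f v).bfs A d T).1.next (s.mem 4)) :
    WP w matchCycles (fun t s' => t ≤ n * 10 + (5 + 200 * (d * M)) * n + 2 ∧
      ((s'.reg 7 = 1 ∧ ∃ τ, IsIso n A B τ) ∨ (s'.reg 7 = 0 ∧ ¬ ∃ τ, IsIso n A B τ))) s := by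
  have hff : ∀ x, n ≤ x → f x = x := fun x hx => by rw [← hf]; exact hA _ x (.inr hx)
  set jv := s.reg 5 with hjv
  set g := B jv with hg
  have hgf : ∀ x, n ≤ x → g x = x := fun x hx => hB _ x (.inr hx)
  have hfpos := minimalPeriod_pos_of_mem_periodicPts (f.mem_periodicPts_of_fixes hff v)
  set σ := ((CycConfig.start n f v).bfs A d T).1.next with hσ
  have hrg : ∀ x ∈ [0, 1, 2, 3, 4, 5, 6], x ∉ [7, 9, 10, 11, 12, 13, 14, 15, 16, 17, 18, 19, 20,
    21, 23, 24, 25, 26, 27, 28, 29, 30, 31, 32, 33] := by decide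
  -- As long as register `7` is `0`, no isomorphism sends a point of `V` into the cycle of `v`. Once
  -- it is `1`, an isomorphism exists and later trials cannot reset it.
  refine WP.mono (wp_forLoop (fun m φ s' => ∃ V ⊆ Finset.range n, (∀ x, g x ∈ V ↔ x ∈ V) ∧
      Marks n 10 jv V s' ∧ φ = (5 + 200 * (d * M)) * (n - V.card) ∧ (∀ x < m, x ∈ V) ∧
      ((s'.reg 7 = 1 ∧ ∃ τ, IsIso n A B τ) ∨
        (s'.reg 7 = 0 ∧ ∀ x ∈ V, ¬ ∃ τ, IsIso n A B τ ∧ f.SameCycle v (τ x))))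
    (φ := (5 + 200 * (d * M)) * n) (c := 8) h2 (by omega)
    (by simp [build, startCycle, search, positions, displacements, growPass, compare, forLoop,
      walk, Prog.regs]) ?_ ?_) ?_
  · exact ⟨∅, by simp, by simp, fun x _ => by simpa using hV jv x, by simp, by simp,
      .inr ⟨by simp [h7], by simp⟩⟩
  · rintro i φ s₁ hi h9 ⟨V, hVn, hVc, hVm, rfl, hVi, hres⟩ hf₁
    rw [h0] at hi
    have hreg₁ : ∀ x ∈ [0, 1, 2, 3, 4, 5, 6], s₁.reg x = s.reg x := fun x hx =>
      hf₁.reg x (by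
        have := hrg x hx
        simp only [List.mem_cons, List.not_mem_nil, not_or, or_false] at this
        simp [build, startCycle, search, positions, displacements, growPass, compare, forLoop,
          walk, Prog.regs, this])
    have hmem₁ : ∀ k ∈ [1, 2, 4], s₁.mem k = s.mem k := fun k hk =>
      hf₁.mem k (by
        simp only [List.mem_cons, List.not_mem_nil, or_false] at hk
        simp [build, startCycle, search, positions, displacements, growPass, compare, forLoop,
          walk, Prog.segs]; omega)
    rw [wp_seq]
    refine (wp_walk (f := g) (iv := i) (jv := jv) (V := V) hn hgf hVn hVc (by simp) (by simp)
      (by rw [hreg₁ 2 (by simp), h2]) (by rw [hreg₁ 3 (by simp), h3]) (hreg₁ 5 (by simp)) h9 hi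
      (fun x hx => by rw [hmem₁ 1 (by simp), hT _ h5 x hx]) hVm).mono ?_
    rintro t₂ s₂ ⟨ht₂, -, V', hVn', hVc', hVm', hcard, hV', hlen⟩ hf₂
    have hreg₂ : ∀ x ∈ [0, 1, 2, 3, 4, 5, 6, 7, 9], s₂.reg x = s₁.reg x := fun x hx =>
      hf₂.reg x (by simp at hx; simp [walk, Prog.regs]; omega)
    have hreg₂' : ∀ x ∈ [0, 1, 2, 3, 4, 5, 6], s₂.reg x = s.reg x := fun x hx => by
      rw [hreg₂ x (by simp at hx ⊢; omega), hreg₁ x hx]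
    have hmem₂ : ∀ k ∈ [1, 2, 4], s₂.mem k = s.mem k := fun k hk => by
      rw [hf₂.mem k (by simp at hk; simp [walk, Prog.segs]; omega), hmem₁ k hk]
    have hle := Finset.card_le_card hVn'
    rw [Finset.card_range] at hle
    have hsub : V ⊆ V' := fun y hy => (hV' y).2 (.inl hy)
    have hVi' : ∀ x < i + 1, x ∈ V' := fun x hx => by
      rw [hV']
      rcases Nat.lt_succ_iff_lt_or_eq.1 hx with h | rfl
      · exact .inl (hVi x h)
      · exact .inr (Equiv.Perm.SameCycle.refl _ _)
    -- The new points form the cycle of `i`, so excluding `i` excludes all of them.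
    have hback : ∀ τ, IsIso n A B τ → ∀ x ∈ V', x ∉ V → f.SameCycle v (τ x) →
        f.SameCycle v (τ i) := fun τ hτ x hx hxV h => by
      have hc : ∀ x, f (τ x) = τ (g x) := fun x => by rw [← hf]; exact hτ.comm _ x
      exact h.trans (Equiv.Perm.sameCycle_of_conj hc (((hV' x).1 hx).resolve_left hxV)).symm
    have hφ : (5 + 200 * (d * M)) * (n - V.card) = (5 + 200 * (d * M)) * (n - V'.card) +
        (5 + 200 * (d * M)) * s₂.reg 11 := by
      rw [← mul_add]; congr 1; omega
    have e11 : (5 + 200 * (d * M)) * s₂.reg 11 = 5 * s₂.reg 11 + 200 * (d * (M * s₂.reg 11)) := by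
      ring
    rw [wp_ite]
    constructor
    · intro heq
      simp only [Test.Holds, hreg₂' 4 (by simp), h4] at heq
      have hiV : i ∉ V := fun h => by
        rw [if_pos h] at hlen
        omega
      rw [if_neg hiV] at hlen
      have hdn : d * n ≤ d * (M * s₂.reg 11) := Nat.mul_le_mul_left d (by rwa [heq])
      rw [wp_seq]
      refine (wp_build (f := g) (v := i) hn hd hd1 (by omega) (by simp) hB htr hi
        (by rw [hreg₂' 0 (by simp), h0]) (by rw [hreg₂' 1 (by simp), h1])
        (by rw [hreg₂' 2 (by simp), h2]) (by rw [hreg₂' 3 (by simp), h3])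
        (by rw [hreg₂' 5 (by simp)]; exact h5) (by rw [hreg₂' 5 (by simp)])
        (by rw [hreg₂' 4 (by simp), h4, ← heq, hlen]) (by rw [hreg₂ 9 (by simp), h9])
        (fun j hj x hx => by rw [hmem₂ 1 (by simp), hT j hj x hx])).mono ?_
      rintro t₃ s₃ ⟨ht₃, T', hTe', hN', hD'⟩ hf₃
      have hreg₃ : ∀ x ∈ [0, 1, 2, 3, 4, 5, 6, 7, 9], s₃.reg x = s₂.reg x := fun x hx =>
        hf₃.reg x (by
          simp only [List.mem_cons, List.not_mem_nil, or_false] at hx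
          simp [build, startCycle, search, positions, displacements, growPass, forLoop, Prog.regs]
          omega)
      have hmem₃ : ∀ k ∈ [2, 4, 10], s₃.mem k = s₂.mem k := fun k hk =>
        hf₃.mem k (by
          simp only [List.mem_cons, List.not_mem_nil, or_false] at hk
          simp [build, startCycle, search, positions, displacements, growPass, forLoop, Prog.segs]
          omega)
      refine (wp_compare (A := A) (B := B) (σ := σ) (S := s.mem 4) hn hd hd1
        (by rw [hreg₃ 0 (by simp), hreg₂' 0 (by simp), h0])
        (by rw [hreg₃ 1 (by simp), hreg₂' 1 (by simp), h1])
        (by rw [hreg₃ 2 (by simp), hreg₂' 2 (by simp), h2])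
        (by rw [hreg₃ 3 (by simp), hreg₂' 3 (by simp), h3])
        (by rw [hreg₃ 6 (by simp), hreg₂' 6 (by simp), h6])
        (by rw [hreg₃ 9 (by simp), hreg₂ 9 (by simp), h9]) hD hD'
        (fun x hx => by rw [hmem₃ 2 (by simp), hmem₂ 2 (by simp), hN x hx]) hN'
        (by rw [hmem₃ 4 (by simp), hmem₂ 4 (by simp)]) rfl).mono ?_
      rintro t₄ s₄ ⟨ht₄, hcmp⟩ hf₄
      refine ⟨(5 + 200 * (d * M)) * (n - V'.card), by omega, V', hVn', hVc', ?_, rfl, hVi', ?_⟩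
      · intro x hx
        rw [setReg_mem, hf₄.mem 10 (by simp [compare, Prog.segs]), hmem₃ 10 (by simp), hVm' x hx]
      · simp only [setReg_reg, Nat.reduceEqDiff, if_false]
        rw [hreg₃ 7 (by simp), hreg₂ 7 (by simp)] at hcmp
        rcases hcmp with ⟨h7', i₀, j₀, hm⟩ | ⟨h7', hno⟩
        · exact .inl ⟨h7', hD.exists_isIso hD' hA hB hm⟩
        · rw [h7']
          refine hres.imp_right fun ⟨hz, hres⟩ => ⟨hz, fun x hx => ?_⟩
          by_cases hxV : x ∈ V
          · exact hres x hxV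
          · rintro ⟨τ, hτ, hvx⟩
            have hvi := hback τ hτ x hx hxV hvx
            have hc : ∀ x, f (τ x) = τ (g x) := fun x => by rw [← hf]; exact hτ.comm _ x
            -- A compatible isomorphism would make the two grown orders conjugate and the words
            -- rotations of each other, which the comparison has refuted.
            have hconj := (CycConfig.Conj.start hτ.lt_iff hc hvi).bfs_of_empty hτ.comm hTe hTe'
            obtain ⟨i₀, h⟩ := hD.dispWord_eq_of_isIso hD' hτ hconj.next
            exact hno ⟨i₀, 0, h⟩
    · intro hne
      simp only [Test.Holds, hreg₂' 4 (by simp), h4] at hne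
      rw [wp_skip]
      refine ⟨(5 + 200 * (d * M)) * (n - V'.card), by omega, V', hVn', hVc', ?_, rfl, hVi', ?_⟩
      · intro x hx
        rw [setReg_mem, hVm' x hx]
      · simp only [setReg_reg, Nat.reduceEqDiff, if_false, hreg₂ 7 (by simp)]
        refine hres.imp_right fun ⟨hz, hres⟩ => ⟨hz, fun x hx => ?_⟩
        by_cases hxV : x ∈ V
        · exact hres x hxV
        · rintro ⟨τ, hτ, hvx⟩
          have hvi := hback τ hτ x hx hxV hvx
          have hc : ∀ x, f (τ x) = τ (g x) := fun x => by rw [← hf]; exact hτ.comm _ x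
          -- An isomorphism preserves cycle lengths, so a cycle of a different length needs no
          -- trial.
          have hp := hvi.minimalPeriod_eq (f.mem_periodicPts_of_fixes hff v)
          rw [Equiv.Perm.minimalPeriod_of_conj hc] at hp
          split_ifs at hlen with hiV
          · exact hxV (Finset.eq_of_subset_of_card_le hsub (by omega) ▸ hx)
          · omega
  · rintro t s' ⟨φ, ht, V, hVn, hVc, hVm, rfl, hVi, hres⟩ -
    rw [h0] at ht hVi
    refine ⟨by omega, hres.imp_right fun ⟨h7', hno⟩ => ⟨h7', ?_⟩⟩
    rintro ⟨τ, hτ⟩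
    -- At the end all points are in `V`, in particular the preimage of `v` under any isomorphism.
    have hx : τ.symm v < n := by rw [← hτ.lt_iff]; simpa using hv
    exact hno _ (hVi _ hx) ⟨τ, hτ, by simp [Equiv.Perm.SameCycle.refl]⟩

/-- The program for the simultaneous conjugacy problem. -/
def conjugacyProgram : Prog :=
  .seq (.const 2 1) (.seq longestCycle (.seq (build 0 6) (.seq matchCycles (.copy 0 7))))

/-- The number of cycles enters only through `hM`, applied to the length found by `wp_longestCycle`;
the program itself does not know `M`. -/
theorem wp_conjugacyProgram {w n d M : ℕ} {A B : ℕ → Equiv.Perm ℕ} {s : State}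
    (hn : n < 2 ^ w) (hd : d < 2 ^ w) (hn1 : 1 ≤ n) (hd1 : 1 ≤ d)
    (hA : ∀ j x, d ≤ j ∨ n ≤ x → A j x = x) (hB : ∀ j x, d ≤ j ∨ n ≤ x → B j x = x)
    (htrA : TransitiveBelow n d A) (htrB : TransitiveBelow n d B)
    (hM : ∀ L, (∀ j < d, ∀ x < n, minimalPeriod (A j) x ≤ L) → n ≤ M * L)
    (h0 : s.reg 0 = n) (h1 : s.reg 1 = d) (hr : ∀ x, 2 ≤ x → s.reg x = 0)
    (hTA : Tabulated n d 0 A s) (hTB : Tabulated n d 1 B s)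
    (hm : ∀ k, 2 ≤ k → ∀ j x, s.mem k j x = 0) :
    WP w conjugacyProgram (fun t s' => t ≤ (200 * M + 200) * (d * n) ∧
      (s'.reg 0 ≠ 0 ↔ ∃ τ, IsIso n A B τ)) s := by
  have hw : 1 < 2 ^ w := by omega
  rw [conjugacyProgram, wp_seq, wp_const, wp_seq]
  refine (wp_longestCycle hn hd hn1 hd1 hA (by simp [h0]) (by simp [h1])
    (by simp [Nat.mod_eq_of_lt hw]) (by simp [hr]) (by simp [hr])
    (fun j hj x hx => by rw [setReg_mem, hTA j hj x hx])
    (fun j x => by rw [setReg_mem, hm 9 (by omega)])).mono ?_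
  rintro t₁ s₁ ⟨ht₁, h5, h6, h4, hmax⟩ hf₁
  have q1 : ∀ x ∈ [0, 1, 3, 7], s₁.reg x = s.reg x := fun x hx => by
    simp only [List.mem_cons, List.not_mem_nil, or_false] at hx
    rw [hf₁.reg x (by simp [longestCycle, forLoop, walk, Prog.regs]; omega), setReg_reg,
      if_neg (by omega)]
  have q1' : s₁.reg 2 = 1 := by
    rw [hf₁.reg 2 (by simp [longestCycle, forLoop, walk, Prog.regs])]
    simp [Nat.mod_eq_of_lt hw]
  have g1 : ∀ k, k ≠ 9 → s₁.mem k = s.mem k := fun k hk =>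
    hf₁.mem k (by simp [longestCycle, forLoop, walk, Prog.segs, hk])
  rw [wp_seq]
  refine (wp_build (k := 0) (rt := 6) hn hd hd1 (by omega) (by simp) hA htrA h6
    (by rw [q1 0 (by simp), h0]) (by rw [q1 1 (by simp), h1]) q1'
    (by rw [q1 3 (by simp), hr 3 (by omega)]) h5 rfl h4 rfl
    (fun j hj x hx => by rw [g1 0 (by omega), hTA j hj x hx])).mono ?_
  rintro t₂ s₂ ⟨ht₂, T, hTe, hN, hD⟩ hf₂
  have q2 : ∀ x ∈ [0, 1, 2, 3, 4, 5, 6, 7], s₂.reg x = s₁.reg x := fun x hx =>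
    hf₂.reg x (by
      simp only [List.mem_cons, List.not_mem_nil, or_false] at hx
      simp [build, startCycle, search, positions, displacements, growPass, forLoop, Prog.regs]
      omega)
  have g2 : ∀ k ∈ [1, 10], s₂.mem k = s₁.mem k := fun k hk =>
    hf₂.mem k (by
      simp only [List.mem_cons, List.not_mem_nil, or_false] at hk
      simp [build, startCycle, search, positions, displacements, growPass, forLoop, Prog.segs]
      omega)
  rw [wp_seq]
  refine (wp_matchCycles (M := M) hn hd hd1 hA hB htrB
    (by rw [q2 0 (by simp), q1 0 (by simp), h0]) (by rw [q2 1 (by simp), q1 1 (by simp), h1])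
    (by rw [q2 2 (by simp), q1']) (by rw [q2 3 (by simp), q1 3 (by simp), hr 3 (by omega)])
    (by rw [q2 4 (by simp), h4]) (by rw [q2 5 (by simp)]; exact h5) (by rw [q2 5 (by simp)])
    (q2 6 (by simp)) h6 (by rw [q2 7 (by simp), q1 7 (by simp), hr 7 (by omega)])
    (h4 ▸ hM _ hmax) (fun j hj x hx => by
      rw [g2 1 (by simp), g1 1 (by omega), hTB j hj x hx])
    (fun j x => by rw [g2 10 (by simp), g1 10 (by omega), hm 10 (by omega)]) hTe hN hD).mono ?_
  rintro t₃ s₃ ⟨ht₃, hres⟩ hf₃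
  rw [wp_copy]
  constructor
  · have e1 : n ≤ d * n := Nat.le_mul_of_pos_left n hd1
    have e2 : d ≤ d * n := Nat.le_mul_of_pos_right d hn1
    have e3 : d * (16 * n + 4) = 16 * (d * n) + 4 * d := by ring
    have e4 : (5 + 200 * (d * M)) * n = 5 * n + 200 * (M * (d * n)) := by ring
    have e5 : (200 * M + 200) * (d * n) = 200 * (M * (d * n)) + 200 * (d * n) := by ring
    omega
  · rcases hres with ⟨h7, h⟩ | ⟨h7, h⟩
    · simp [h7, Nat.mod_eq_of_lt hw, h]
    · simpa [h7] using h

end WordRAM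

/-! ## From permutations of `Fin n` to permutations of `ℕ` -/

/-- A permutation of `{0, …, n - 1}` as a permutation of `ℕ`. -/
def extendPerm {n : ℕ} (σ : Equiv.Perm (Fin n)) : Equiv.Perm ℕ :=
  σ.extendDomain Fin.equivSubtype

theorem extendPerm_val {n : ℕ} (σ : Equiv.Perm (Fin n)) (i : Fin n) :
    extendPerm σ i = (σ i : ℕ) :=
  Equiv.Perm.extendDomain_apply_image σ Fin.equivSubtype i

theorem extendPerm_of_le {n : ℕ} (σ : Equiv.Perm (Fin n)) {x : ℕ} (hx : n ≤ x) :
    extendPerm σ x = x :=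
  Equiv.Perm.extendDomain_apply_not_subtype σ Fin.equivSubtype (not_lt.2 hx)

theorem extendPerm_lt_iff {n : ℕ} (σ : Equiv.Perm (Fin n)) (x : ℕ) : extendPerm σ x < n ↔ x < n := by
  rcases lt_or_ge x n with h | h
  · have := extendPerm_val σ ⟨x, h⟩
    simp only [h, iff_true]
    simp only at this
    rw [this]
    exact (σ _).2
  · rw [extendPerm_of_le σ h]

/-- A tuple of permutations of `{0, …, n - 1}` as a family of permutations of `ℕ`. -/
def extendTuple {n d : ℕ} (a : Fin d → Equiv.Perm (Fin n)) (j : ℕ) : Equiv.Perm ℕ :=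
  if h : j < d then extendPerm (a ⟨j, h⟩) else 1

theorem extendTuple_val {n d : ℕ} (a : Fin d → Equiv.Perm (Fin n)) (j : Fin d) :
    extendTuple a j = extendPerm (a j) := by
  simp [extendTuple]

theorem extendTuple_fixes {n d : ℕ} (a : Fin d → Equiv.Perm (Fin n)) (j x : ℕ)
    (h : d ≤ j ∨ n ≤ x) : extendTuple a j x = x := by
  rw [extendTuple]
  split_ifs with hj
  · exact extendPerm_of_le _ (by omega)
  · rfl

theorem exists_isIso_iff {n d : ℕ} (a b : Fin d → Equiv.Perm (Fin n)) :
    (∃ τ, IsIso n (extendTuple a) (extendTuple b) τ) ↔ SimultaneouslyConjugate a b := by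
  constructor
  · rintro ⟨τ, hτ⟩
    let t : Fin n → Fin n := fun i => ⟨τ i, (hτ.lt_iff i).2 i.2⟩
    have ht : Injective t := fun i j h => Fin.ext (τ.injective (congrArg Fin.val h))
    refine ⟨Equiv.ofBijective t (Finite.injective_iff_bijective.1 ht), fun j => ?_⟩
    rw [mul_assoc, eq_inv_mul_iff_mul_eq]
    ext i
    have := hτ.comm j i
    simp only [extendTuple_val, extendPerm_val] at this
    simp only [Equiv.Perm.mul_apply, Equiv.ofBijective_apply]
    rw [← extendPerm_val (a j) (t i)]
    exact this.symm
  · rintro ⟨τ, hτ⟩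
    refine ⟨extendPerm τ, extendPerm_lt_iff τ, fun j x => ?_⟩
    rcases lt_or_ge x n with hx | hx
    · rcases lt_or_ge j d with hj | hj
      · have h1 := extendTuple_val a ⟨j, hj⟩
        have h2 := extendTuple_val b ⟨j, hj⟩
        have h3 := fun σ : Equiv.Perm (Fin n) => extendPerm_val σ ⟨x, hx⟩
        simp only at h1 h2 h3
        rw [h1, h2, h3, h3, extendPerm_val, extendPerm_val, hτ]
        simp
      · rw [extendTuple_fixes a _ _ (.inl hj), extendTuple_fixes b _ _ (.inl hj)]
    · rw [extendPerm_of_le τ hx, extendTuple_fixes a _ _ (.inr hx),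
        extendTuple_fixes b _ _ (.inr hx), extendPerm_of_le τ hx]

/-- A finite set mapped into itself by a permutation is mapped onto itself, so forward closure under
the generators already gives invariance under the whole group. -/
theorem GeneratesTransitive.transitiveBelow {n d : ℕ} {a : Fin d → Equiv.Perm (Fin n)}
    (h : GeneratesTransitive a) : TransitiveBelow n d (extendTuple a) := by
  intro R hR hne hcl
  have hinv : ∀ g ∈ Subgroup.closure (Set.range a), ∀ i : Fin n, (i : ℕ) ∈ R ↔ (g i : ℕ) ∈ R := by
    intro g hg
    induction hg using Subgroup.closure_induction with
    | mem g hg =>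
      obtain ⟨j, rfl⟩ := hg
      have himg : R.image (extendTuple a j) = R :=
        Finset.eq_of_subset_of_card_le (Finset.image_subset_iff.2 fun x hx => hcl j j.2 x hx)
          (Finset.card_image_of_injective _ (extendTuple a j).injective).ge
      intro i
      rw [← extendPerm_val, ← extendTuple_val]
      refine ⟨fun hi => hcl j j.2 _ hi, fun hi => ?_⟩
      rw [← himg] at hi
      obtain ⟨x, hx, he⟩ := Finset.mem_image.1 hi
      rwa [← (extendTuple a j).injective he]
    | one => simp
    | mul g g' _ _ h h' => intro i; rw [Equiv.Perm.mul_apply, ← h, ← h']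
    | inv g _ h => intro i; rw [h (g⁻¹ i)]; simp
  refine Finset.Subset.antisymm hR fun y hy => ?_
  obtain ⟨x, hx⟩ := hne
  have hxn : x < n := by simpa using hR hx
  rw [Finset.mem_range] at hy
  obtain ⟨g, hg⟩ := h.exists_smul_eq ⟨x, hxn⟩ ⟨y, hy⟩
  have hg' : g.1 ⟨x, hxn⟩ = ⟨y, hy⟩ := hg
  have := (hinv g.1 g.2 ⟨x, hxn⟩).1 hx
  rwa [hg'] at this

theorem minimalPeriod_extendPerm {n : ℕ} (σ : Equiv.Perm (Fin n)) (i : Fin n) :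
    minimalPeriod (extendPerm σ) i = minimalPeriod σ i := by
  rw [minimalPeriod_eq_minimalPeriod_iff]
  have hit : ∀ k, (extendPerm σ)^[k] i = (σ^[k] i : Fin n) := fun k => by
    induction k with
    | zero => rfl
    | succ k ih => rw [iterate_succ_apply', ih, extendPerm_val, iterate_succ_apply']
  intro k
  rw [IsPeriodicPt, IsFixedPt, IsPeriodicPt, IsFixedPt, hit, Fin.val_inj]

/-- If no cycle is longer than `L`, then the number of cycles is at least `n / L`. -/
theorem le_numCycles_mul {n L : ℕ} (σ : Equiv.Perm (Fin n)) (h : ∀ i, minimalPeriod σ i ≤ L) :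
    n ≤ numCycles σ * L := by
  have hpos : ∀ i, 0 < minimalPeriod σ i := fun i =>
    minimalPeriod_pos_of_mem_periodicPts (σ.injective.mem_periodicPts i)
  have hle : ∀ m ∈ σ.partition.parts, m ≤ L := by
    intro m hm
    rw [Equiv.Perm.parts_partition, Multiset.mem_add] at hm
    rcases hm with hm | hm
    · rw [Equiv.Perm.cycleType_def, Multiset.mem_map] at hm
      obtain ⟨c, hc, rfl⟩ := hm
      rw [Finset.mem_val] at hc
      have hc' := Equiv.Perm.mem_cycleFactorsFinset_iff.1 hc
      obtain ⟨x, hx⟩ := hc'.1.nonempty_support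
      have hsub : c.support ⊆ (Finset.range (minimalPeriod σ x)).image fun k => σ^[k] x := by
        intro y hy
        obtain ⟨k, rfl⟩ := hc'.1.exists_pow_eq (Equiv.Perm.mem_support.1 hx)
          (Equiv.Perm.mem_support.1 hy)
        rw [Equiv.Perm.cycle_is_cycleOf hx hc, Equiv.Perm.cycleOf_pow_apply_self]
        exact Finset.mem_image.2 ⟨k % minimalPeriod σ x, by simpa using Nat.mod_lt _ (hpos x),
          by rw [iterate_mod_minimalPeriod_eq, Equiv.Perm.iterate_eq_pow]⟩
      calc c.support.card ≤ _ := Finset.card_le_card hsub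
        _ ≤ (Finset.range (minimalPeriod σ x)).card := Finset.card_image_le
        _ ≤ L := by rw [Finset.card_range]; exact h x
    -- The parts not in `cycleType` are the fixed points, of size `1`; then `n ≠ 0` and `L` is at
    -- least some positive period.
    · obtain ⟨h0, rfl⟩ := Multiset.mem_replicate.1 hm
      cases n with
      | zero => simp at h0
      | succ n => exact (hpos 0).trans_le (h 0)
  calc n = σ.partition.parts.sum := by rw [σ.partition.parts_sum, Fintype.card_fin]
    _ ≤ _ := Multiset.sum_le_card_nsmul _ _ hle

/-! ### The main theorem -/

theorem mainTheorem8 :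
    ∃ P : WordRAM.Prog, ∀ Λ : ℕ, ∃ C : ℝ,
      ∀ (w n d : ℕ), 1 ≤ n → 1 ≤ d → n < 2 ^ w → d < 2 ^ w →
      ∀ a b : Fin d → Equiv.Perm (Fin n),
        GeneratesTransitive a → GeneratesTransitive b → minCycles a ≤ Λ →
        ∃ (t : ℕ) (s : WordRAM.State),
          WordRAM.Run w P (WordRAM.input a b) t s ∧
          (s.Accepts ↔ SimultaneouslyConjugate a b) ∧
          (2 ≤ n → (t : ℝ) ≤ C * (d * n * Real.log n)) := by
  -- The program runs in `(200 * Λ + 200) * (d * n)` steps; dividing by `Real.log 2` absorbs the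
  -- factor `Real.log n ≥ Real.log 2`.
  refine ⟨WordRAM.conjugacyProgram, fun Λ => ⟨(200 * Λ + 200) / Real.log 2, ?_⟩⟩
  intro w n d hn1 hd1 hn hd a b ha hb hΛ
  have htab : ∀ (c : Fin d → Equiv.Perm (Fin n)), ∀ j < d, ∀ x < n,
      WordRAM.table c j x = extendTuple c j x := fun c j hj x hx => by
    have h1 := extendTuple_val c ⟨j, hj⟩
    have h2 := extendPerm_val (c ⟨j, hj⟩) ⟨x, hx⟩
    simp only at h1 h2
    rw [h1, h2, WordRAM.table, dif_pos ⟨hj, hx⟩]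
  obtain ⟨t, s, hrun, ht, hres⟩ := WordRAM.wp_conjugacyProgram (M := Λ) (s := WordRAM.input a b)
    hn hd hn1 hd1 (extendTuple_fixes a) (extendTuple_fixes b) ha.transitiveBelow hb.transitiveBelow
    (fun L hL => by
      have : Nonempty (Fin d) := ⟨⟨0, hd1⟩⟩
      obtain ⟨j, hj⟩ := exists_eq_ciInf_of_finite (f := fun j => numCycles (a j))
      have hL' : ∀ i, minimalPeriod (a j) i ≤ L := fun i => by
        rw [← minimalPeriod_extendPerm, ← extendTuple_val]
        exact hL j j.2 i i.2
      exact (le_numCycles_mul (a j) hL').trans (Nat.mul_le_mul_right L (hj.trans_le hΛ)))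
    rfl rfl (fun x hx => by simp [WordRAM.input, show x ≠ 0 by omega, show x ≠ 1 by omega])
    (htab a) (htab b)
    (fun k hk j x => by simp [WordRAM.input, show k ≠ 0 by omega, show k ≠ 1 by omega])
  refine ⟨t, s, hrun, hres.trans (exists_isIso_iff a b), fun hn2 => ?_⟩
  have hlog2 : 0 < Real.log 2 := Real.log_pos (by norm_num)
  have hlog : Real.log 2 ≤ Real.log n := Real.log_le_log (by norm_num) (by exact_mod_cast hn2)
  calc (t : ℝ) ≤ (200 * Λ + 200) * (d * n) := by exact_mod_cast ht
    _ = (200 * Λ + 200) / Real.log 2 * (d * n * Real.log 2) := by field_simp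
    _ ≤ _ := by gcongr
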